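/- Let $k$ be an algebraically closed field and let $\Gamma$ be an ADE Dynkin diagram ($A_n$ with $n\ge1$, $D_n$ with $n\ge4$, or $E_6,E_7,E_8$) with vertices $1,\dots,n$: in type $A_n$ the edges form the chain $1-2-\cdots-n$; in types $D_n$ and $E_n$ they form the chain $1-2-\cdots-(n-1)$, and vertex $n$ is joined to $n-2$ (type $D_n$) or to $3$ (type $E_n$). Fix polynomials $P'_1,\dots,P'_n\in k[x]$. The associated $N=1$ ADE quiver has a loop $e_i$ at every vertex $i$ and, for every edge of $\Gamma$ with ends $i,j$, two arrows $e_{ij}\colon j\to i$ and $e_{ji}\colon i\to j$, with the relations $$\sum_i s_{ij}\,e_{ji}e_{ij}+P'_j(e_j)=0,\qquad e_{ij}e_j=e_ie_{ij},$$ where $s_{ij}=0$ if $i,j$ are not adjacent, and for adjacent $i,j$, $s_{ij}=1$ if $i>j$ and $s_{ij}=-1$ if $i<j$. Representations are finite-dimensional over $k$. Let $\mathfrak W_\Gamma$ be the Weyl group, generated by the simple reflections $r_1,\dots,r_n$ of the root lattice $\mathbb Z^n$, and let the roots be the images under $\mathfrak W_\Gamma$ of the simple roots $\varepsilon_1,\dots,\varepsilon_n$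 (the standard basis vectors). A root is positive if all its coordinates are nonnegative. For $\alpha\in\mathbb Z^n$ put $P'_\alpha=\sum_i\alpha_iP'_i$, and let $\mathfrak W_\Gamma$ act by $w(P'_j)=P'_{w(\varepsilon_j)}$; thus $r_i(P'_i)=-P'_i$, $r_i(P'_j)=P'_j+P'_i$ if $j$ is adjacent to $i$, and $r_i(P'_j)=P'_j$ otherwise. Let $\mathcal B_\Gamma=\{w(P'_j)\mid w\in\mathfrak W_\Gamma,\ 1\le j\le n\}$. Assume: - every element of $\mathcal B_\Gamma$ is a nonzero polynomial with only simple roots; - $(*)$ if $a,b\in\mathbb Z^n\setminus\{0\}$ and $P'_a$, $P'_b$ have a common root in $k$, then $b=ca$ for some constant $c\in\mathbb Q$. Then there is a finite-to-one correspondence between the isomorphism classes of simple representations of the $N=1$ ADE quiver and the positive roots of $\Gamma$, given by the dimension vector. Precisely: 1. If $V$ is a simple representation, then its dimension vector $\alpha=(\dim V(i))_i$ is a positive root, and there is a $\lambda\in k$ with $P'_\alpha(\lambda)=0$ such that every loop $e_i$ acts on $V(i)$ as the scalar $\lambda$. 2. If $\lambda\in k$ is a root of some $p\in\mathcal B_\Gamma$,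 then there is, up to isomorphism, exactly one simple representation $V$ on which all loops act as the scalar $\lambda$; its dimension vector $\alpha$ is a positive root and $p=\pm P'_\alpha$. 3. For every positive root $\alpha$ the number of isomorphism classes of simple representations with dimension vector $\alpha$ is finite, and is equal to $\deg P'_\alpha$. (In particular, $\alpha$ occurs if and only if $P'_\alpha$ is not constant.) -/

import Mathlib

namespace N1ADE

universe u

/-- The ADE Dynkin types: `A n` (`1 ≤ n`), `D n` (`4 ≤ n`) and `E n` (`n = 6, 7, 8`). -/
inductive DynkinType : Type
  | A (n : ℕ) (hn : 1 ≤ n) : DynkinType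
  | D (n : ℕ) (hn : 4 ≤ n) : DynkinType
  | E (n : ℕ) (hn : 6 ≤ n) (hn' : n ≤ 8) : DynkinType

/-- The number of vertices. -/
def DynkinType.rank : DynkinType → ℕ
  | .A n _ => n
  | .D n _ => n
  | .E n _ _ => n

/-- The edges of the Dynkin diagram, each listed once from its smaller to its larger vertex.
The vertex `i + 1` of the usual numbering `1, …, n` is written `i` here.
* `A n`: the chain `1 - 2 - ⋯ - n`;
* `D n`: the chain `1 - 2 - ⋯ - (n - 1)` together with the edge `(n - 2) - n`;
* `E n`: the chain `1 - 2 - ⋯ - (n - 1)` together with the edge `3 - n`. -/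
def DynkinType.edge : DynkinType → ℕ → ℕ → Prop
  | .A _ _, i, j => i + 1 = j
  | .D n _, i, j => (i + 1 = j ∧ j + 1 < n) ∨ (i + 3 = n ∧ j + 1 = n)
  | .E n _ _, i, j => (i + 1 = j ∧ j + 1 < n) ∨ (i = 2 ∧ j + 1 = n)

/-- The Dynkin diagram as a graph on the vertices `0, …, n - 1`. -/
def DynkinType.graph (Γ : DynkinType) : SimpleGraph (Fin Γ.rank) :=
  SimpleGraph.fromRel fun i j => Γ.edge i j

section Roots

variable {n : ℕ} (G : SimpleGraph (Fin n))

open Classical in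
/-- The simple reflection at the vertex `b`: it changes the coordinate `x_b` into
`- x_b + ∑ x_l`, the sum over the neighbours `l` of `b`, and fixes the other coordinates. On the
simple roots `e_j` it is `e_b ↦ - e_b`, `e_j ↦ e_j + e_b` for `j` adjacent to `b`, and `e_j ↦ e_j`
for the other `j`. -/
noncomputable def reflectionMap (b : Fin n) : (Fin n → ℤ) →ₗ[ℤ] (Fin n → ℤ) where
  toFun x := fun i => if i = b then - x b + ∑ l with G.Adj b l, x l else x i
  map_add' x y := by
    funext i
    by_cases h : i = b
    · simp only [h, if_true, Pi.add_apply, Finset.sum_add_distrib]; ring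
    · simp [h]
  map_smul' c x := by
    funext i
    by_cases h : i = b
    · simp only [h, if_true, Pi.smul_apply, smul_eq_mul, RingHom.id_apply, mul_add,
        Finset.mul_sum, mul_neg]
    · simp [h]

open Classical in
theorem reflectionMap_apply (b : Fin n) (x : Fin n → ℤ) (i : Fin n) :
    reflectionMap G b x i = if i = b then - x b + ∑ l with G.Adj b l, x l else x i := rfl

open Classical in
theorem reflectionMap_involutive (b : Fin n) : Function.Involutive (reflectionMap G b) := by
  intro x
  funext i
  by_cases h : i = b
  · subst h
    have hs : ∑ l with G.Adj i l, reflectionMap G i x l = ∑ l with G.Adj i l, x l := by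
      refine Finset.sum_congr rfl fun l hl => ?_
      rw [reflectionMap_apply, if_neg (Finset.mem_filter.1 hl).2.ne']
    rw [reflectionMap_apply, if_pos rfl, hs, reflectionMap_apply, if_pos rfl]
    ring
  · rw [reflectionMap_apply, if_neg h, reflectionMap_apply, if_neg h]

/-- The simple reflection as an automorphism of the root lattice `ℤⁿ`. -/
noncomputable def reflection (b : Fin n) : (Fin n → ℤ) ≃ₗ[ℤ] (Fin n → ℤ) :=
  LinearEquiv.ofInvolutive (reflectionMap G b) (reflectionMap_involutive G b)

/-- The Weyl group, acting on the root lattice: the group generated by the simple reflections. -/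
noncomputable def weylGroup : Subgroup ((Fin n → ℤ) ≃ₗ[ℤ] (Fin n → ℤ)) :=
  Subgroup.closure (Set.range (reflection G))

/-- Roots, in coordinates with respect to the simple roots: the images of the simple roots `e_j`
under the Weyl group. -/
def IsRoot (α : Fin n → ℤ) : Prop :=
  ∃ w ∈ weylGroup G, ∃ j : Fin n, α = w (Pi.single j 1)

/-- A positive root is a root that is nonzero with all coordinates nonnegative (this is what `<`
means on functions). -/
def IsPositiveRoot (α : Fin n → ℤ) : Prop :=
  IsRoot G α ∧ 0 < α

end Roots

section Polynomials

variable {k : Type u} [Field k] {n : ℕ}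

/-- The polynomial `∑ i, α_i P_i`. -/
noncomputable def comb (P : Fin n → Polynomial k) (α : Fin n → ℤ) : Polynomial k :=
  ∑ i, α i • P i

/-- The set `{w (P_j)}`, for `w` in the Weyl group and `j` a vertex. The Weyl group acts on integral
combinations of the `P_j` by acting on the coefficient vectors, so that the simple reflection at
`b` sends `P_b` to `- P_b`, sends `P_j` to `P_j + P_b` for `j` adjacent to `b`, and fixes the other
`P_j`. -/
def weylPolynomials (G : SimpleGraph (Fin n)) (P : Fin n → Polynomial k) : Set (Polynomial k) :=
  {p | ∃ w ∈ weylGroup G, ∃ j : Fin n, p = comb P (w (Pi.single j 1))}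

/-- Every root of `p` is simple. The zero polynomial does not have this property. -/
def HasSimpleRoots (p : Polynomial k) : Prop :=
  ∀ x, p.IsRoot x → ¬ p.derivative.IsRoot x

/-- Two integral combinations `∑ n_i P_i` and `∑ m_i P_i` with nonzero coefficient vectors have no
common root, unless the coefficient vectors are proportional. -/
def StarCondition (P : Fin n → Polynomial k) : Prop :=
  ∀ a b : Fin n → ℤ, a ≠ 0 → b ≠ 0 →
    (∃ x, (comb P a).IsRoot x ∧ (comb P b).IsRoot x) → ∃ c : ℚ, ∀ i, (b i : ℚ) = c * (a i : ℚ)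

end Polynomials

section Representations

variable {k : Type u} [Field k] {n : ℕ}

open Classical in
/-- The sign `s_{ij}`: `0` if `i`, `j` are not adjacent, and for adjacent `i`, `j` it is
`1` if `i > j` and `-1` if `i < j`. -/
noncomputable def sgn (G : SimpleGraph (Fin n)) (i j : Fin n) : ℤ :=
  if G.Adj i j then (if j < i then 1 else -1) else 0

/-- A finite-dimensional representation over `k` of the quiver with relations attached to the
graph `G` and the polynomials `P`. The quiver has a loop `e_i` at each vertex `i` and, for each edge
of `G`, a pair of opposite arrows `e_{ij} : j → i` and `e_{ji} : i → j`; the relations are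
`∑ i, s_{ij} e_{ji} e_{ij} + P_j(e_j) = 0` and `e_{ij} e_j = e_i e_{ij}`. There is an arrow `j → i`
for adjacent `i`, `j` only, and `Q i j` is set to `0` for the other pairs. -/
structure Rep (G : SimpleGraph (Fin n)) (P : Fin n → Polynomial k) : Type (u + 1) where
  V : Fin n → Type u
  [addCommGroup : ∀ i, AddCommGroup (V i)]
  [module : ∀ i, Module k (V i)]
  [finite : ∀ i, Module.Finite k (V i)]
  Φ : ∀ i, Module.End k (V i)
  Q : ∀ i j, V j →ₗ[k] V i
  Q_eq_zero : ∀ i j, ¬ G.Adj i j → Q i j = 0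
  relation : ∀ j, ∑ i, sgn G i j • (Q j i ∘ₗ Q i j) + Polynomial.aeval (Φ j) (P j) = 0
  comm : ∀ i j, Q i j ∘ₗ Φ j = Φ i ∘ₗ Q i j

attribute [instance] Rep.addCommGroup Rep.module Rep.finite

namespace Rep

variable {G : SimpleGraph (Fin n)} {P : Fin n → Polynomial k}

/-- A family of subspaces is a subrepresentation if all structure maps preserve it. -/
def IsSubrep (R : Rep G P) (W : ∀ i, Submodule k (R.V i)) : Prop :=
  (∀ i, ∀ v ∈ W i, R.Φ i v ∈ W i) ∧ ∀ i j, ∀ v ∈ W j, R.Q i j v ∈ W i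

/-- Simple representations: nonzero, and the only subrepresentations are zero and the whole. -/
def IsSimple (R : Rep G P) : Prop :=
  (∃ i, Nontrivial (R.V i)) ∧
    ∀ W : ∀ i, Submodule k (R.V i), R.IsSubrep W → (∀ i, W i = ⊥) ∨ (∀ i, W i = ⊤)

/-- Isomorphism of representations. -/
def Iso (R S : Rep G P) : Prop :=
  ∃ h : ∀ i, R.V i ≃ₗ[k] S.V i,
    (∀ i v, h i (R.Φ i v) = S.Φ i (h i v)) ∧ ∀ i j v, h i (R.Q i j v) = S.Q i j (h j v)

/-- The dimension vector. -/
noncomputable def dim (R : Rep G P) : Fin n → ℤ :=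
  fun i => (Module.finrank k (R.V i) : ℤ)

/-- All loops act as the scalar `x`. -/
def LoopsActBy (R : Rep G P) (x : k) : Prop :=
  ∀ i v, R.Φ i v = x • v

theorem Iso.refl (R : Rep G P) : R.Iso R :=
  ⟨fun i => LinearEquiv.refl k (R.V i), fun _ _ => rfl, fun _ _ _ => rfl⟩

theorem Iso.symm {R S : Rep G P} : R.Iso S → S.Iso R := by
  rintro ⟨h, h1, h2⟩
  refine ⟨fun i => (h i).symm, fun i v => ?_, fun i j v => ?_⟩
  · rw [LinearEquiv.symm_apply_eq, h1, LinearEquiv.apply_symm_apply]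
  · rw [LinearEquiv.symm_apply_eq, h2, LinearEquiv.apply_symm_apply]

theorem Iso.trans {R S T : Rep G P} : R.Iso S → S.Iso T → R.Iso T := by
  rintro ⟨h, h1, h2⟩ ⟨g, g1, g2⟩
  exact ⟨fun i => (h i).trans (g i), fun i v => by simp [h1, g1], fun i j v => by simp [h2, g2]⟩

theorem Iso.dim_eq {R S : Rep G P} : R.Iso S → R.dim = S.dim := by
  rintro ⟨h, -, -⟩
  funext i
  simp only [dim, (h i).finrank_eq]

end Rep

/-- Isomorphism as an equivalence relation on the simple representations. -/
def simpleSetoid (G : SimpleGraph (Fin n)) (P : Fin n → Polynomial k) :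
    Setoid {R : Rep G P // R.IsSimple} where
  r R S := R.1.Iso S.1
  iseqv := ⟨fun R => Rep.Iso.refl R.1, Rep.Iso.symm, Rep.Iso.trans⟩

/-- Isomorphism classes of simple representations. -/
def SimpleClass (G : SimpleGraph (Fin n)) (P : Fin n → Polynomial k) : Type (u + 1) :=
  Quotient (simpleSetoid G P)

/-- The dimension vector of an isomorphism class of simple representations. -/
noncomputable def SimpleClass.dim {G : SimpleGraph (Fin n)} {P : Fin n → Polynomial k}
    (c : SimpleClass G P) : Fin n → ℤ :=
  Quotient.lift (fun R : {R : Rep G P // R.IsSimple} => R.1.dim)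
    (fun _ _ h => Rep.Iso.dim_eq h) c

end Representations

end N1ADE

/-! On a simple representation the loops act by one scalar `x`, because they commute with every
arrow and an eigenspace of them is a subrepresentation. What remains is a module over a deformed
preprojective algebra with weights `w_j = P_j(x)`. Taking traces in its relations makes the arrow
terms cancel by antisymmetry of the signs, so the dimension vector `α` satisfies `P_α(x) = 0`
(`LoopsActBy.isRoot_comb_dim`).

For two such modules `R`, `S` with the same scalar, the commutation defect and the linearized
relation form a three-term complex whose Euler characteristic is the Cartan form of the dimension
vectors. Trace duality then gives `(dim R, dim S) ≤ dim Hom(R, S) + dim Hom(S, R)` (`bform_dim_le`).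
By Schur's lemma a simple `R` has `(α, α) ≤ 2`. The form is even and positive definite on an ADE
diagram, so `(α, α) = 2`, and the nonnegative vectors of this length are exactly the positive roots.

Uniqueness: by `(*)` the dimension vectors of two simples with the same scalar are proportional.
Being positive roots, they are equal, so the inequality yields a nonzero homomorphism, which is an
isomorphism.

Existence: reflection functors at vertices of nonzero weight carry a one-dimensional module at a
vertex to any positive root `α` with `P_α(x) = 0` (`exists_dim_eq`). The result is simple, since the
dimension vector of a nonzero subrepresentation is again annihilated by the weights, hence
proportional to `α`, and no shorter than `α`.

Thus the simples of dimension `α` correspond to the roots of `P_α`, which are simple and therefore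
number `deg P_α`. -/

namespace N1ADE

universe u

/-! ### The Cartan form and vectors of square length two -/

section CartanForm

variable {n : ℕ} (G : SimpleGraph (Fin n))

open Classical in
/-- The symmetric bilinear form given by the Cartan matrix of the graph. -/
noncomputable def bform : LinearMap.BilinForm ℤ (Fin n → ℤ) :=
  Matrix.toBilin' ((2 : ℤ) • (1 : Matrix (Fin n) (Fin n) ℤ) - G.adjMatrix ℤ)

/-- The pairing with the simple root at `i`. -/
noncomputable def cartan (x : Fin n → ℤ) (i : Fin n) : ℤ := bform G (Pi.single i 1) x

open Classical in
theorem bform_eq_sum (x y : Fin n → ℤ) :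
    bform G x y = ∑ i, x i * (2 * y i - ∑ l with G.Adj i l, y l) := by
  simp only [bform, Matrix.toBilin'_apply', Matrix.sub_mulVec, Matrix.smul_mulVec,
    Matrix.one_mulVec, dotProduct]
  refine Finset.sum_congr rfl fun i _ => ?_
  simp [SimpleGraph.adjMatrix_mulVec_apply, SimpleGraph.neighborFinset_eq_filter]

open Classical in
theorem cartan_eq (x : Fin n → ℤ) (i : Fin n) :
    cartan G x i = 2 * x i - ∑ l with G.Adj i l, x l := by
  rw [cartan, bform_eq_sum, Finset.sum_eq_single i]
  · simp
  · intro j _ hj; simp [hj]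
  · simp

theorem bform_eq_sum_cartan (x y : Fin n → ℤ) : bform G x y = ∑ i, x i * cartan G y i := by
  classical
  rw [bform_eq_sum]
  simp only [cartan_eq]

open Classical in
theorem bform_eq_sub (x y : Fin n → ℤ) :
    bform G x y = 2 * ∑ i, x i * y i - ∑ i, ∑ j, if G.Adj i j then x i * y j else 0 := by
  rw [bform_eq_sum, Finset.mul_sum, ← Finset.sum_sub_distrib]
  refine Finset.sum_congr rfl fun i _ => ?_
  rw [mul_sub, Finset.mul_sum, Finset.sum_filter]
  ring

theorem bform_comm (x y : Fin n → ℤ) : bform G x y = bform G y x := by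
  classical
  rw [bform_eq_sub, bform_eq_sub, Finset.sum_comm]
  simp only [G.adj_comm, mul_comm]

-- Counting each edge once exhibits the factor 2: the form is even, so by integrality nonzero
-- vectors have length at least two once it is positive definite.
open Classical in
theorem bform_self (x : Fin n → ℤ) :
    bform G x x =
      2 * (∑ i, x i ^ 2 - ∑ i, ∑ j, if G.Adj i j ∧ i < j then x i * x j else 0) := by
  have h : (∑ i, ∑ j, if G.Adj i j then x i * x j else 0)
      = (∑ i, ∑ j, if G.Adj i j ∧ i < j then x i * x j else 0)
        + ∑ i, ∑ j, if G.Adj j i ∧ j < i then x j * x i else 0 := by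
    simp only [← Finset.sum_add_distrib]
    refine Finset.sum_congr rfl fun i _ => Finset.sum_congr rfl fun j _ => ?_
    rw [G.adj_comm j i, mul_comm (x j)]
    by_cases hij : G.Adj i j
    · rcases lt_or_gt_of_ne hij.ne with h | h <;> simp [hij, h, h.not_gt]
    · simp [hij]
  rw [bform_eq_sub, h,
    Finset.sum_comm (f := fun i j : Fin n => if G.Adj j i ∧ j < i then x j * x i else 0)]
  simp only [sq]
  ring

theorem two_dvd_bform_self (x : Fin n → ℤ) : 2 ∣ bform G x x := by
  classical
  exact ⟨_, bform_self G x⟩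

theorem bform_single_self (i : Fin n) : bform G (Pi.single i 1) (Pi.single i 1) = 2 := by
  classical
  change cartan G _ i = 2
  rw [cartan_eq, Finset.sum_eq_zero]
  · simp
  · intro l hl
    exact Pi.single_eq_of_ne (Finset.mem_filter.1 hl).2.ne' _

theorem reflectionMap_eq (b : Fin n) (x : Fin n → ℤ) :
    reflectionMap G b x = x - cartan G x b • Pi.single b 1 := by
  classical
  funext i
  rw [reflectionMap_apply, cartan_eq]
  by_cases h : i = b
  · subst h
    simp
    ring
  · simp [h]

theorem bform_reflectionMap (b : Fin n) (x : Fin n → ℤ) :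
    bform G (reflectionMap G b x) (reflectionMap G b x) = bform G x x := by
  rw [reflectionMap_eq]
  have h := bform_single_self G b
  have h' : bform G x (Pi.single b 1) = cartan G x b := bform_comm G _ _
  have h'' : bform G (Pi.single b 1) x = cartan G x b := rfl
  simp only [map_sub, map_smul, LinearMap.sub_apply, LinearMap.smul_apply, smul_eq_mul, h, h', h'']
  ring

theorem reflection_apply (b : Fin n) (x : Fin n → ℤ) : reflection G b x = reflectionMap G b x :=
  rfl

variable {G}

theorem IsRoot.single (i : Fin n) : IsRoot G (Pi.single i 1) := ⟨1, one_mem _, i, rfl⟩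

theorem IsRoot.reflectionMap {α : Fin n → ℤ} (h : IsRoot G α) (b : Fin n) :
    IsRoot G (reflectionMap G b α) := by
  obtain ⟨w, hw, j, rfl⟩ := h
  exact ⟨reflection G b * w, mul_mem (Subgroup.subset_closure ⟨b, rfl⟩) hw, j, rfl⟩

theorem bform_weylGroup {w : (Fin n → ℤ) ≃ₗ[ℤ] (Fin n → ℤ)} (hw : w ∈ weylGroup G)
    (x : Fin n → ℤ) : bform G (w x) (w x) = bform G x x := by
  induction hw using Subgroup.closure_induction generalizing x with
  | mem w hw =>
    obtain ⟨b, rfl⟩ := hw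
    exact bform_reflectionMap G b x
  | one => rfl
  | mul v w _ _ hv hw => rw [LinearEquiv.mul_apply, hv, hw]
  | inv v _ hv =>
    rw [← hv]
    have : v (v⁻¹ x) = x := v.apply_symm_apply x
    rw [this]

theorem IsRoot.bform_self {α : Fin n → ℤ} (h : IsRoot G α) : bform G α α = 2 := by
  obtain ⟨w, hw, j, rfl⟩ := h
  rw [bform_weylGroup hw, bform_single_self]

theorem IsRoot.neg {α : Fin n → ℤ} (h : IsRoot G α) : IsRoot G (-α) := by
  obtain ⟨w, hw, j, rfl⟩ := h
  refine ⟨w * reflection G j, mul_mem hw (Subgroup.subset_closure ⟨j, rfl⟩), j, ?_⟩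
  rw [LinearEquiv.mul_apply, reflection_apply, reflectionMap_eq, cartan, bform_single_self,
    ← map_neg]
  congr 1
  rw [two_smul]
  abel

variable (G) in
/-- Positive definiteness of the Cartan form. -/
def PosDef : Prop := ∀ x : Fin n → ℤ, x ≠ 0 → 0 < bform G x x

theorem PosDef.two_le (hG : PosDef G) {x : Fin n → ℤ} (hx : x ≠ 0) : 2 ≤ bform G x x :=
  Int.le_of_dvd (hG x hx) (two_dvd_bform_self G x)

/-- Induction on positive vectors of square length two: such a vector is either simple or becomes
smaller under a simple reflection. -/
theorem PosDef.induction (hG : PosDef G) {motive : (Fin n → ℤ) → Prop}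
    (single : ∀ i, motive (Pi.single i 1))
    (step : ∀ α i, bform G α α = 2 → 0 ≤ reflectionMap G i α → cartan G α i = 1 →
      motive (reflectionMap G i α) → motive α)
    (α : Fin n → ℤ) (h0 : 0 ≤ α) (h2 : bform G α α = 2) : motive α := by
  obtain ⟨m, hm⟩ : ∃ m : ℕ, ∑ i, α i = m :=
    Int.eq_ofNat_of_zero_le (Finset.sum_nonneg fun i _ => h0 i)
  induction m using Nat.strong_induction_on generalizing α with
  | _ m ih =>
  -- The products `α i * cartan G α i` sum to `(α, α) = 2`, so one of them is positive.
  obtain ⟨i, hi⟩ : ∃ i, 0 < α i * cartan G α i := by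
    by_contra! h
    have := Finset.sum_nonpos fun i (_ : i ∈ Finset.univ) => h i
    rw [← bform_eq_sum_cartan] at this
    omega
  have hi0 : 0 < α i := lt_of_le_of_ne (h0 i) fun h => by simp [← h] at hi
  have hc : 0 < cartan G α i := pos_of_mul_pos_right hi hi0.le
  have hsub : bform G (α - Pi.single i 1) (α - Pi.single i 1) = 4 - 2 * cartan G α i := by
    have h := bform_single_self G i
    have h' : bform G α (Pi.single i 1) = cartan G α i := bform_comm G _ _
    have h'' : bform G (Pi.single i 1) α = cartan G α i := rfl
    simp only [map_sub, LinearMap.sub_apply, h, h', h'', h2]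
    ring
  by_cases hs : α = Pi.single i 1
  · exact hs ▸ single i
  -- The nonzero vector `α - ε_i` has length `4 - 2 * cartan G α i`, which must be at least 2. So
  -- the reflection subtracts exactly one `ε_i`, keeping nonnegativity and lowering the height by
  -- one.
  · have h1 : cartan G α i = 1 := by
      have := hG.two_le (sub_ne_zero.2 hs)
      omega
    have hr : reflectionMap G i α = α - Pi.single i 1 := by
      rw [reflectionMap_eq, h1, one_smul]
    have hr0 : 0 ≤ reflectionMap G i α := by
      rw [hr]
      intro j
      by_cases hj : j = i
      · subst hj
        simp
        omega
      · simpa [hj] using h0 j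
    refine step α i h2 hr0 h1 ?_
    refine ih (m - 1) ?_ _ hr0 (by rw [bform_reflectionMap, h2]) ?_
    · have : α i ≤ ∑ i, α i := Finset.single_le_sum (fun j _ => h0 j) (Finset.mem_univ i)
      omega
    · have : α i ≤ ∑ i, α i := Finset.single_le_sum (fun j _ => h0 j) (Finset.mem_univ i)
      rw [hr]
      simp only [Pi.sub_apply, Finset.sum_sub_distrib, Finset.sum_pi_single', hm]
      simp
      omega

theorem PosDef.isRoot (hG : PosDef G) {α : Fin n → ℤ} (h0 : 0 ≤ α) (h2 : bform G α α = 2) :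
    IsRoot G α := by
  refine hG.induction (motive := IsRoot G) IsRoot.single (fun α i _ _ _ h => ?_) α h0 h2
  have := h.reflectionMap i
  rwa [reflectionMap_involutive G i α] at this

theorem PosDef.isPositiveRoot (hG : PosDef G) {α : Fin n → ℤ} (h0 : 0 ≤ α)
    (h2 : bform G α α = 2) : IsPositiveRoot G α := by
  refine ⟨hG.isRoot h0 h2, lt_of_le_of_ne h0 ?_⟩
  rintro rfl
  simp at h2

/-- The positive and negative parts have disjoint supports, so they pair nonpositively. If both were
nonzero, the length would be at least 2 + 2. -/
theorem PosDef.nonneg_or_nonpos (hG : PosDef G) {α : Fin n → ℤ} (h : bform G α α = 2) :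
    0 ≤ α ∨ 0 ≤ -α := by
  have hneg : bform G α⁺ α⁻ ≤ 0 := by
    classical
    rw [bform_eq_sub, Finset.sum_eq_zero, mul_zero, zero_sub, neg_nonpos]
    · refine Finset.sum_nonneg fun i _ => Finset.sum_nonneg fun j _ => ?_
      split_ifs
      · exact mul_nonneg (posPart_nonneg α i) (negPart_nonneg α j)
      · rfl
    · intro i _
      rw [Pi.posPart_apply, Pi.negPart_apply, posPart_def, negPart_def]
      rcases le_total 0 (α i) with h | h
      · rw [sup_eq_right.2 (by simpa using h : -α i ≤ 0), mul_zero]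
      · rw [sup_eq_right.2 h, zero_mul]
  have hsplit : bform G α α
      = bform G α⁺ α⁺ + bform G α⁻ α⁻ - 2 * bform G α⁺ α⁻ := by
    conv_lhs => rw [← posPart_sub_negPart α]
    simp only [map_sub, LinearMap.sub_apply, bform_comm G α⁻ α⁺]
    ring
  by_cases hp : α⁺ = 0
  · right
    rw [← posPart_sub_negPart α, hp, zero_sub, neg_neg]
    exact negPart_nonneg α
  · by_cases hm : α⁻ = 0
    · left
      rw [← posPart_sub_negPart α, hm, sub_zero]
      exact posPart_nonneg α
    · have := hG.two_le hp
      have := hG.two_le hm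
      omega

/-- A nonzero integral vector proportional to a vector of square length two is at least as long. -/
theorem PosDef.one_le_sq_of_proportional (hG : PosDef G) {a b : Fin n → ℤ} (ha : bform G a a = 2)
    (hb : b ≠ 0) {c : ℚ} (h : ∀ i, (b i : ℚ) = c * a i) :
    (bform G b b : ℚ) = 2 * c ^ 2 ∧ 1 ≤ c ^ 2 := by
  classical
  have hbb : (bform G b b : ℚ) = c ^ 2 * (bform G a a : ℤ) := by
    rw [bform_eq_sub, bform_eq_sub]
    push_cast
    simp only [h, mul_sub, Finset.mul_sum, mul_ite, mul_zero]
    congr 1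
    · exact Finset.sum_congr rfl fun i _ => by ring
    · refine Finset.sum_congr rfl fun i _ => Finset.sum_congr rfl fun j _ => ?_
      split_ifs <;> ring
  rw [ha] at hbb
  have h2 : (2 : ℚ) ≤ bform G b b := by exact_mod_cast hG.two_le hb
  push_cast at hbb
  constructor <;> linarith

theorem PosDef.eq_or_eq_neg (hG : PosDef G) {a b : Fin n → ℤ} (ha : bform G a a = 2)
    (hb : bform G b b = 2) {c : ℚ} (h : ∀ i, (b i : ℚ) = c * a i) : b = a ∨ b = -a := by
  have hb0 : b ≠ 0 := by
    rintro rfl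
    simp at hb
  have hc := (hG.one_le_sq_of_proportional ha hb0 h).1
  rw [hb] at hc
  push_cast at hc
  have hc1 : c = 1 ∨ c = -1 := mul_self_eq_one_iff.1 (by linarith)
  rcases hc1 with rfl | rfl
  · left
    funext i
    have := h i
    rw [one_mul] at this
    exact_mod_cast this
  · right
    funext i
    have := h i
    rw [neg_one_mul] at this
    exact_mod_cast this

end CartanForm

/-! ### Positive definiteness for the ADE diagrams -/

section Dynkin

/-- Minimizing the form of a chain with `m + 1` vertices for a fixed last value `f m`, cleared of
denominators. This sharp bound measures how much a chain contributes at the vertex where it is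
attached. -/
theorem chain_form_lower_bound (f : ℕ → ℤ) (m : ℕ) :
    (m + 2) * f m ^ 2 ≤ 2 * (m + 1) *
      (∑ i ∈ Finset.range (m + 1), f i ^ 2 - ∑ i ∈ Finset.range m, f i * f (i + 1)) := by
  induction m with
  | zero => simp
  | succ m ih =>
    rw [Finset.sum_range_succ (fun i => f i ^ 2) (m + 1),
      Finset.sum_range_succ (fun i => f i * f (i + 1)) m]
    set S := ∑ i ∈ Finset.range (m + 1), f i ^ 2
    set T := ∑ i ∈ Finset.range m, f i * f (i + 1)
    push_cast
    -- The square completed in `f m`: for fixed `f (m + 1)` the minimum is where it vanishes.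
    have hsq := sq_nonneg ((m + 2) * f m - (m + 1) * f (m + 1))
    have h1 : (0 : ℤ) < m + 1 := by positivity
    refine le_of_mul_le_mul_left ?_ h1
    have := mul_le_mul_of_nonneg_left ih (by positivity : (0 : ℤ) ≤ m + 2)
    linarith

theorem chain_form_eq_zero (f : ℕ → ℤ) (m : ℕ)
    (h : ∑ i ∈ Finset.range (m + 1), f i ^ 2 - ∑ i ∈ Finset.range m, f i * f (i + 1) ≤ 0) :
    ∀ i ≤ m, f i = 0 := by
  induction m with
  | zero =>
    intro i hi
    obtain rfl : i = 0 := by omega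
    exact pow_eq_zero_iff two_ne_zero |>.1 (le_antisymm (by simpa using h) (sq_nonneg _))
  | succ m ih =>
    have hm : f (m + 1) = 0 := by
      have := chain_form_lower_bound f (m + 1)
      have h' := mul_nonpos_of_nonneg_of_nonpos
        (by positivity : (0 : ℤ) ≤ 2 * (((m + 1 : ℕ) : ℤ) + 1)) h
      have h2 : f (m + 1) ^ 2 ≤ 0 := by
        push_cast at this h'
        have hp : (0 : ℤ) < m + 1 + 2 := by positivity
        exact nonpos_of_mul_nonpos_right (this.trans h') hp
      exact pow_eq_zero_iff two_ne_zero |>.1 (le_antisymm h2 (sq_nonneg _))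
    intro i hi
    rcases hi.lt_or_eq with hi | rfl
    · refine ih ?_ i (by omega)
      rw [Finset.sum_range_succ (fun i => f i ^ 2) (m + 1),
        Finset.sum_range_succ (fun i => f i * f (i + 1)) m, hm] at h
      simpa using h
    · exact hm

theorem bform_fromRel_self {n : ℕ} (r : ℕ → ℕ → Prop) [DecidableRel r]
    (hr : ∀ i j, r i j → i < j) (f : ℕ → ℤ) :
    bform (SimpleGraph.fromRel fun i j : Fin n => r i j) (fun i => f i) (fun i => f i)
      = 2 * (∑ i ∈ Finset.range n, f i ^ 2
        - ∑ i ∈ Finset.range n, ∑ j ∈ Finset.range n, if r i j then f i * f j else 0) := by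
  classical
  rw [bform_self]
  simp only [Finset.sum_range]
  congr 2
  refine Finset.sum_congr rfl fun i _ => Finset.sum_congr rfl fun j _ => ?_
  have : ((SimpleGraph.fromRel fun i j : Fin n => r i j).Adj i j ∧ i < j) ↔ r i j := by
    rw [SimpleGraph.fromRel_adj]
    constructor
    · rintro ⟨⟨_, h | h⟩, hij⟩
      · exact h
      · exact absurd hij (Fin.lt_def.2 (hr _ _ h)).not_gt
    · intro h
      have hij : i < j := Fin.lt_def.2 (hr _ _ h)
      exact ⟨⟨hij.ne, Or.inl h⟩, hij⟩
  simp only [this]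

/-- A graph whose edges are given by an increasing relation has a positive definite Cartan form if
the corresponding sum has no nontrivial nonpositive value. -/
theorem posDef_fromRel {n : ℕ} (r : ℕ → ℕ → Prop) [DecidableRel r] (hr : ∀ i j, r i j → i < j)
    (h : ∀ f : ℕ → ℤ, ∑ i ∈ Finset.range n, f i ^ 2
        - (∑ i ∈ Finset.range n, ∑ j ∈ Finset.range n, if r i j then f i * f j else 0) ≤ 0 →
      ∀ i < n, f i = 0) :
    PosDef (SimpleGraph.fromRel fun i j : Fin n => r i j) := by
  intro x hx
  by_contra! hle
  refine hx (funext fun i => ?_)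
  -- Extending the vector by zero to all of `ℕ` lets the sums run over ranges.
  obtain ⟨f, rfl⟩ : ∃ f : ℕ → ℤ, x = fun i : Fin n => f i :=
    ⟨fun m => if h : m < n then x ⟨m, h⟩ else 0, by funext i; simp⟩
  rw [bform_fromRel_self r hr] at hle
  exact h f (by linarith) i i.2

theorem sum_edges_chain (m : ℕ) (f : ℕ → ℤ) :
    (∑ i ∈ Finset.range (m + 1), ∑ j ∈ Finset.range (m + 1), if i + 1 = j then f i * f j else 0)
      = ∑ i ∈ Finset.range m, f i * f (i + 1) := by
  rw [Finset.sum_range_succ]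
  simp only [Finset.sum_ite_eq, Finset.mem_range]
  rw [if_neg (by omega), add_zero]
  exact Finset.sum_congr rfl fun i hi => if_pos (by simpa using hi)

/-- Types D and E together: a chain on `0, …, m` and one further vertex `m + 1` attached to `t`. -/
theorem sum_edges_fork (m t : ℕ) (ht : t ≤ m) (f : ℕ → ℤ) :
    (∑ i ∈ Finset.range (m + 2), ∑ j ∈ Finset.range (m + 2),
        if (i + 1 = j ∧ j + 1 < m + 2) ∨ (i = t ∧ j + 1 = m + 2) then f i * f j else 0)
      = ∑ i ∈ Finset.range m, f i * f (i + 1) + f t * f (m + 1) := by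
  have h : ∀ i ∈ Finset.range (m + 2), (∑ j ∈ Finset.range (m + 2),
        if (i + 1 = j ∧ j + 1 < m + 2) ∨ (i = t ∧ j + 1 = m + 2) then f i * f j else 0)
      = (if i < m then f i * f (i + 1) else 0) + if i = t then f t * f (m + 1) else 0 := by
    intro i _
    rw [Finset.sum_range_succ]
    congr 1
    · by_cases him : i < m
      · rw [if_pos him, Finset.sum_eq_single (i + 1)]
        · exact if_pos (by omega)
        · intro j hj hne
          rw [Finset.mem_range] at hj
          exact if_neg (by omega)
        · intro hj
          rw [Finset.mem_range] at hj
          omega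
      · rw [if_neg him]
        refine Finset.sum_eq_zero fun j hj => ?_
        rw [Finset.mem_range] at hj
        exact if_neg (by omega)
    · by_cases hit : i = t
      · subst hit
        rw [if_pos (by omega), if_pos rfl]
      · rw [if_neg (by omega), if_neg hit]
  rw [Finset.sum_congr rfl h, Finset.sum_add_distrib, Finset.sum_range_succ, Finset.sum_range_succ,
    Finset.sum_congr rfl fun i hi => if_pos (Finset.mem_range.1 hi)]
  simp only [Finset.sum_ite_eq', Finset.mem_range]
  rw [if_neg (by omega), if_neg (by omega), if_pos (by omega), add_zero, add_zero]

theorem posDef_A (n : ℕ) (hn : 1 ≤ n) : PosDef (DynkinType.A n hn).graph := by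
  obtain ⟨m, rfl⟩ : ∃ m, n = m + 1 := ⟨n - 1, by omega⟩
  refine posDef_fromRel (n := m + 1) (fun i j => i + 1 = j) (fun i j h => by omega) ?_
  intro f hf i hi
  rw [sum_edges_chain] at hf
  exact chain_form_eq_zero f m hf i (by omega)

theorem posDef_fork (m t : ℕ) (ht : t ≤ m)
    (h : ∀ f : ℕ → ℤ, ∑ i ∈ Finset.range (m + 2), f i ^ 2
        - (∑ i ∈ Finset.range m, f i * f (i + 1) + f t * f (m + 1)) ≤ 0 → ∀ i < m + 2, f i = 0) :
    PosDef (SimpleGraph.fromRel fun i j : Fin (m + 2) =>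
      ((i : ℕ) + 1 = j ∧ (j : ℕ) + 1 < m + 2) ∨ ((i : ℕ) = t ∧ (j : ℕ) + 1 = m + 2)) := by
  refine posDef_fromRel (n := m + 2)
    (fun i j => (i + 1 = j ∧ j + 1 < m + 2) ∨ (i = t ∧ j + 1 = m + 2)) (fun i j h => by omega) ?_
  intro f hf
  rw [sum_edges_fork m t ht] at hf
  exact h f hf

theorem posDef_D (n : ℕ) (hn : 4 ≤ n) : PosDef (DynkinType.D n hn).graph := by
  obtain ⟨m, rfl⟩ : ∃ m, n = m + 3 := ⟨n - 3, by omega⟩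
  have hrel : (DynkinType.D (m + 3) hn).graph = SimpleGraph.fromRel fun i j : Fin (m + 1 + 2) =>
      ((i : ℕ) + 1 = j ∧ (j : ℕ) + 1 < m + 1 + 2) ∨ ((i : ℕ) = m ∧ (j : ℕ) + 1 = m + 1 + 2) := by
    refine congrArg SimpleGraph.fromRel (funext fun i => funext fun j => ?_)
    simp only [DynkinType.edge, eq_iff_iff]
    omega
  rw [hrel]
  refine posDef_fork (m + 1) m (by omega) fun f hf i hi => ?_
  rw [Finset.sum_range_succ, Finset.sum_range_succ,
    Finset.sum_range_succ (fun i => f i * f (i + 1)) m] at hf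
  have hb := chain_form_lower_bound f m
  set S := ∑ i ∈ Finset.range (m + 1), f i ^ 2
  have hz := chain_form_eq_zero f m
  set T := ∑ i ∈ Finset.range m, f i * f (i + 1)
  -- Each of the two end vertices costs at most `f m ^ 2 / 4`, so `2 * (S - T) ≤ f m ^ 2`. The chain
  -- bound has the larger factor `(m + 2) / (m + 1)`, which forces `f m = 0`.
  have hq : 2 * (m + 1) * (S - T) ≤ (m + 1) * f m ^ 2 := by
    have h1 : 2 * (S - T) ≤ f m ^ 2 := by
      nlinarith [sq_nonneg (2 * f (m + 1) - f m), sq_nonneg (2 * f (m + 2) - f m)]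
    have := mul_le_mul_of_nonneg_left h1 (by positivity : (0 : ℤ) ≤ m + 1)
    linarith
  have h0 : f m = 0 := by
    have h2 : f m ^ 2 ≤ 0 := by linarith
    exact pow_eq_zero_iff two_ne_zero |>.1 (le_antisymm h2 (sq_nonneg _))
  rw [h0] at hf
  have hST : S - T ≤ 0 := by
    nlinarith [sq_nonneg (f (m + 1)), sq_nonneg (f (m + 2))]
  have hST' : 0 ≤ S - T := by
    rw [h0] at hb
    have hp : (0 : ℤ) < 2 * (m + 1) := by positivity
    exact nonneg_of_mul_nonneg_right (by simpa using hb) hp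
  have h1 : f (m + 1) = 0 := by
    refine pow_eq_zero_iff two_ne_zero |>.1 (le_antisymm ?_ (sq_nonneg _))
    nlinarith [sq_nonneg (f (m + 2))]
  have h2 : f (m + 2) = 0 := by
    refine pow_eq_zero_iff two_ne_zero |>.1 (le_antisymm ?_ (sq_nonneg _))
    nlinarith [sq_nonneg (f (m + 1))]
  have : i ≤ m ∨ i = m + 1 ∨ i = m + 2 := by omega
  rcases this with h | rfl | rfl
  · exact hz hST i h
  · exact h1
  · exact h2

theorem posDef_E (n : ℕ) (hn : 6 ≤ n) (hn' : n ≤ 8) : PosDef (DynkinType.E n hn hn').graph := by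
  obtain ⟨m, rfl⟩ : ∃ m, n = m + 2 := ⟨n - 2, by omega⟩
  refine posDef_fork m 2 (by omega) fun f hf i hi => ?_
  have key : ∀ a b : ℤ, a ^ 2 ≤ 0 → (a = 0 → b = 0) → b = 0 := fun a b h hab =>
    hab (pow_eq_zero_iff two_ne_zero |>.1 (le_antisymm h (sq_nonneg _)))
  have hm : m = 4 ∨ m = 5 ∨ m = 6 := by omega
  -- Complete squares along the three arms at vertex 2, from their ends inwards. In half the form,
  -- an arm with `l` vertices costs `l / (2 * (l + 1))` of the coefficient of `f 2 ^ 2`. The arms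
  -- have 2, 1 and `m - 2` vertices and leave 1/12, 1/24 or 1/60. Hence `f 2 = 0`, and the squares
  -- then kill each arm outwards.
  have hsq := fun a : ℤ => sq_nonneg a
  have s0 := hsq (2 * f 0 - f 1)
  have s1 := hsq (3 * f 1 - 2 * f 2)
  have s2 := hsq (f 2)
  have s3 := hsq (2 * f (m + 1) - f 2)
  rcases hm with rfl | rfl | rfl <;> simp only [Finset.sum_range_succ, Finset.sum_range_zero] at hf
  · have s4 := hsq (2 * f 4 - f 3)
    have s5 := hsq (3 * f 3 - 2 * f 2)
    have z2 : f 2 = 0 := key (f 2) _ (by linarith) id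
    have z1 : f 1 = 0 := key (3 * f 1 - 2 * f 2) _ (by linarith) (by omega)
    have z0 : f 0 = 0 := key (2 * f 0 - f 1) _ (by linarith) (by omega)
    have z3 : f 3 = 0 := key (3 * f 3 - 2 * f 2) _ (by linarith) (by omega)
    have z4 : f 4 = 0 := key (2 * f 4 - f 3) _ (by linarith) (by omega)
    have z5 : f 5 = 0 := key (2 * f 5 - f 2) _ (by linarith) (by omega)
    interval_cases i <;> assumption
  · have s4 := hsq (2 * f 5 - f 4)
    have s5 := hsq (3 * f 4 - 2 * f 3)
    have s6 := hsq (4 * f 3 - 3 * f 2)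
    have z2 : f 2 = 0 := key (f 2) _ (by linarith) id
    have z1 : f 1 = 0 := key (3 * f 1 - 2 * f 2) _ (by linarith) (by omega)
    have z0 : f 0 = 0 := key (2 * f 0 - f 1) _ (by linarith) (by omega)
    have z3 : f 3 = 0 := key (4 * f 3 - 3 * f 2) _ (by linarith) (by omega)
    have z4 : f 4 = 0 := key (3 * f 4 - 2 * f 3) _ (by linarith) (by omega)
    have z5 : f 5 = 0 := key (2 * f 5 - f 4) _ (by linarith) (by omega)
    have z6 : f 6 = 0 := key (2 * f 6 - f 2) _ (by linarith) (by omega)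
    interval_cases i <;> assumption
  · have s4 := hsq (2 * f 6 - f 5)
    have s5 := hsq (3 * f 5 - 2 * f 4)
    have s6 := hsq (4 * f 4 - 3 * f 3)
    have s7 := hsq (5 * f 3 - 4 * f 2)
    have z2 : f 2 = 0 := key (f 2) _ (by linarith) id
    have z1 : f 1 = 0 := key (3 * f 1 - 2 * f 2) _ (by linarith) (by omega)
    have z0 : f 0 = 0 := key (2 * f 0 - f 1) _ (by linarith) (by omega)
    have z3 : f 3 = 0 := key (5 * f 3 - 4 * f 2) _ (by linarith) (by omega)
    have z4 : f 4 = 0 := key (4 * f 4 - 3 * f 3) _ (by linarith) (by omega)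
    have z5 : f 5 = 0 := key (3 * f 5 - 2 * f 4) _ (by linarith) (by omega)
    have z6 : f 6 = 0 := key (2 * f 6 - f 5) _ (by linarith) (by omega)
    have z7 : f 7 = 0 := key (2 * f 7 - f 2) _ (by linarith) (by omega)
    interval_cases i <;> assumption

theorem DynkinType.posDef_graph (Γ : DynkinType) : PosDef Γ.graph := by
  cases Γ with
  | A n hn => exact posDef_A n hn
  | D n hn => exact posDef_D n hn
  | E n hn hn' => exact posDef_E n hn hn'

end Dynkin

/-! ### Scalar loops, the trace identity and spaces of homomorphisms -/

section RepTheory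

variable {k : Type u} [Field k] {n : ℕ} {G : SimpleGraph (Fin n)} {P : Fin n → Polynomial k}

theorem sgn_swap (G : SimpleGraph (Fin n)) (i j : Fin n) : sgn G j i = -sgn G i j := by
  unfold sgn
  by_cases h : G.Adj i j
  · rcases lt_or_gt_of_ne h.ne with h' | h' <;> simp [h, h.symm, h', h'.not_gt]
  · have h' : ¬ G.Adj j i := fun h' => h h'.symm
    simp [h, h']

theorem sgn_of_not_adj {i j : Fin n} (h : ¬ G.Adj i j) : sgn G i j = 0 := if_neg h

theorem sgn_mul_self {i j : Fin n} (h : G.Adj i j) : sgn G i j * sgn G i j = 1 := by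
  unfold sgn
  split_ifs <;> simp

theorem sum_sgn_smul {M : Type*} [AddCommGroup M] (t : Fin n → Fin n → M)
    (ht : ∀ i j, t i j = t j i) : ∑ j, ∑ i, sgn G i j • t i j = 0 := by
  classical
  have h : ∀ i j, sgn G i j • t i j = (if G.Adj i j ∧ j < i then t i j else 0)
      - if G.Adj j i ∧ i < j then t j i else 0 := by
    intro i j
    unfold sgn
    rw [G.adj_comm j i, ht j i]
    by_cases hij : G.Adj i j
    · rcases lt_or_gt_of_ne hij.ne with h' | h' <;> simp [hij, h', h'.not_gt]
    · simp [hij]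
  simp only [h, Finset.sum_sub_distrib]
  rw [Finset.sum_comm, sub_self]

/-- Nondegeneracy of the trace pairing, tested on maps of rank at most one. -/
theorem eq_zero_of_trace_comp {V W : Type*} [AddCommGroup V] [Module k V] [Module.Finite k V]
    [AddCommGroup W] [Module k W] [Module.Finite k W] {B : V →ₗ[k] W}
    (h : ∀ A : W →ₗ[k] V, LinearMap.trace k W (B ∘ₗ A) = 0) : B = 0 := by
  ext v
  rw [LinearMap.zero_apply, ← Module.forall_dual_apply_eq_zero_iff k]
  intro φ
  have := h (φ.smulRight v)
  have hB : B ∘ₗ φ.smulRight v = φ.smulRight (B v) := by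
    ext w
    simp
  rwa [hB, LinearMap.trace_smulRight] at this

theorem eval_comb (P : Fin n → Polynomial k) (α : Fin n → ℤ) (x : k) :
    (comb P α).eval x = ∑ i, α i • (P i).eval x := by
  simp [comb, Polynomial.eval_finsetSum]

namespace Rep

/-- With scalar loops only the values `P_j(x)` matter: this is the relation of a deformed
preprojective algebra with those weights. -/
theorem LoopsActBy.relation {R : Rep G P} {x : k} (h : R.LoopsActBy x) (j : Fin n) :
    ∑ i, sgn G i j • (R.Q j i ∘ₗ R.Q i j) = -((P j).eval x) • LinearMap.id := by
  have hΦ : R.Φ j = algebraMap k (Module.End k (R.V j)) x := LinearMap.ext fun v => h j v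
  have := R.relation j
  rw [hΦ, Polynomial.aeval_algebraMap_apply_eq_algebraMap_eval] at this
  rw [eq_neg_of_add_eq_zero_left this, neg_smul]
  rfl

theorem dim_nonneg (R : Rep G P) : 0 ≤ R.dim := fun _ => Int.natCast_nonneg _

/-- The trace identity: the polynomial attached to the dimension vector vanishes at the scalar by
which the loops act. -/
theorem LoopsActBy.isRoot_comb_dim {R : Rep G P} {x : k} (h : R.LoopsActBy x) :
    (comb P R.dim).IsRoot x := by
  have hs : ∑ j, ∑ i, sgn G i j • LinearMap.trace k _ (R.Q j i ∘ₗ R.Q i j) = 0 :=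
    sum_sgn_smul _ fun i j => LinearMap.trace_comp_comm' _ _
  have ht : ∀ j, ∑ i, sgn G i j • LinearMap.trace k _ (R.Q j i ∘ₗ R.Q i j)
      = -(R.dim j • (P j).eval x) := by
    intro j
    have := congrArg (LinearMap.trace k (R.V j)) (h.relation j)
    rw [map_sum] at this
    simp only [map_zsmul] at this
    rw [this, map_smul, LinearMap.trace_id, dim]
    simp [mul_comm]
  simp only [ht, Finset.sum_neg_distrib, neg_eq_zero] at hs
  rw [Polynomial.IsRoot, eval_comb, hs]

/-- The loops commute with all arrows, so their eigenspaces for a common `x` form a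
subrepresentation. It is nonzero when `x` is an eigenvalue at some vertex. -/
theorem IsSimple.exists_loopsActBy [IsAlgClosed k] {R : Rep G P} (hR : R.IsSimple) :
    ∃ x : k, R.LoopsActBy x := by
  obtain ⟨⟨i, hi⟩, hW⟩ := hR
  obtain ⟨x, hx⟩ := Module.End.exists_eigenvalue (R.Φ i)
  refine ⟨x, ?_⟩
  have hsub : R.IsSubrep fun j => (R.Φ j).eigenspace x := by
    constructor
    · intro j v hv
      rw [Module.End.mem_eigenspace_iff] at hv ⊢
      rw [hv, map_smul, hv]
    · intro j l v hv
      rw [Module.End.mem_eigenspace_iff] at hv ⊢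
      have := LinearMap.congr_fun (R.comm j l) v
      simp only [LinearMap.comp_apply] at this
      rw [← this, hv, map_smul]
  rcases hW _ hsub with h | h
  · exact absurd (h i) hx
  · intro j v
    have : v ∈ (R.Φ j).eigenspace x := by
      rw [h j]
      trivial
    exact Module.End.mem_eigenspace_iff.1 this

theorem IsSimple.dim_ne_zero {R : Rep G P} (hR : R.IsSimple) : R.dim ≠ 0 := by
  obtain ⟨⟨i, hi⟩, -⟩ := hR
  intro h
  have : R.dim i = 0 := congrFun h i
  have hpos : 0 < Module.finrank k (R.V i) := Module.finrank_pos
  rw [dim] at this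
  omega

variable (R S : Rep G P)

/-- The families of linear maps commuting with the arrows between different vertices. -/
def homs : Submodule k (∀ i, R.V i →ₗ[k] S.V i) where
  carrier := {f | ∀ i j, f i ∘ₗ R.Q i j = S.Q i j ∘ₗ f j}
  add_mem' hf hg i j := by
    rw [Pi.add_apply, Pi.add_apply, LinearMap.add_comp, LinearMap.comp_add, hf i j, hg i j]
  zero_mem' i j := by
    rw [Pi.zero_apply, Pi.zero_apply, LinearMap.zero_comp, LinearMap.comp_zero]
  smul_mem' c f hf i j := by
    rw [Pi.smul_apply, Pi.smul_apply, LinearMap.smul_comp, LinearMap.comp_smul, hf i j]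

/-- Families of linear maps indexed by the arrows between different vertices. -/
abbrev ArrowMaps : Type u :=
  ∀ p : {p : Fin n × Fin n // G.Adj p.1 p.2}, R.V p.1.2 →ₗ[k] S.V p.1.1

open Classical in
/-- Extension of a family indexed by arrows by zero. -/
noncomputable def arrowExt (i j : Fin n) : ArrowMaps R S →ₗ[k] (R.V j →ₗ[k] S.V i) :=
  if h : G.Adj i j then
    LinearMap.proj (R := k) (φ := fun p : {p : Fin n × Fin n // G.Adj p.1 p.2} =>
      R.V p.1.2 →ₗ[k] S.V p.1.1) ⟨(i, j), h⟩
  else 0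

variable {R S} in
theorem arrowExt_of_adj {i j : Fin n} (h : G.Adj i j) (g : ArrowMaps R S) :
    arrowExt R S i j g = g ⟨(i, j), h⟩ := by
  rw [arrowExt, dif_pos h]
  rfl

variable {R S} in
theorem arrowExt_of_not_adj {i j : Fin n} (h : ¬ G.Adj i j) (g : ArrowMaps R S) :
    arrowExt R S i j g = 0 := by
  rw [arrowExt, dif_neg h]
  rfl

/-- The defect of a family of linear maps from commuting with the arrows. -/
noncomputable def arrowDefect : (∀ i, R.V i →ₗ[k] S.V i) →ₗ[k] ArrowMaps R S where
  toFun f p := f p.1.1 ∘ₗ R.Q p.1.1 p.1.2 - S.Q p.1.1 p.1.2 ∘ₗ f p.1.2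
  map_add' f g := by
    funext p
    simp only [Pi.add_apply, LinearMap.add_comp, LinearMap.comp_add]
    abel
  map_smul' c f := by
    funext p
    simp only [Pi.smul_apply, LinearMap.smul_comp, LinearMap.comp_smul, smul_sub, RingHom.id_apply]

theorem arrowExt_arrowDefect (f : ∀ i, R.V i →ₗ[k] S.V i) (i j : Fin n) :
    arrowExt R S i j (arrowDefect R S f) = f i ∘ₗ R.Q i j - S.Q i j ∘ₗ f j := by
  by_cases h : G.Adj i j
  · rw [arrowExt_of_adj h]
    rfl
  · rw [arrowExt_of_not_adj h, R.Q_eq_zero i j h, S.Q_eq_zero i j h, LinearMap.comp_zero,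
      LinearMap.zero_comp, sub_zero]

theorem ker_arrowDefect_le : LinearMap.ker (arrowDefect R S) ≤ homs R S := by
  intro f hf i j
  have := arrowExt_arrowDefect R S f i j
  rw [LinearMap.mem_ker.1 hf, map_zero] at this
  exact (sub_eq_zero.1 this.symm)

/-- The linearization of the relations at the vertices. -/
noncomputable def relationDefect : ArrowMaps R S →ₗ[k] (∀ i, R.V i →ₗ[k] S.V i) where
  toFun g j := ∑ i, sgn G i j •
    (arrowExt R S j i g ∘ₗ R.Q i j + S.Q j i ∘ₗ arrowExt R S i j g)
  map_add' f g := by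
    funext p
    simp only [map_add, Pi.add_apply, LinearMap.add_comp, LinearMap.comp_add,
      ← Finset.sum_add_distrib, ← smul_add]
    refine Finset.sum_congr rfl fun i _ => congrArg _ ?_
    abel
  map_smul' c f := by
    funext p
    simp only [map_smul, Pi.smul_apply, LinearMap.smul_comp, LinearMap.comp_smul, ← smul_add,
      RingHom.id_apply, Finset.smul_sum, smul_comm c]

-- The composite is zero: the mixed terms cancel, leaving the relation of `R` followed by `f` minus
-- `f` followed by the relation of `S`. Both relations are the same scalar because `x` is common.
variable {R S} in
theorem relationDefect_arrowDefect {x : k} (hR : R.LoopsActBy x) (hS : S.LoopsActBy x)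
    (f : ∀ i, R.V i →ₗ[k] S.V i) : relationDefect R S (arrowDefect R S f) = 0 := by
  funext j
  change ∑ i : Fin n, _ = (0 : R.V j →ₗ[k] S.V j)
  have h : ∀ i, sgn G i j • (arrowExt R S j i (arrowDefect R S f) ∘ₗ R.Q i j
        + S.Q j i ∘ₗ arrowExt R S i j (arrowDefect R S f))
      = f j ∘ₗ (sgn G i j • (R.Q j i ∘ₗ R.Q i j)) - (sgn G i j • (S.Q j i ∘ₗ S.Q i j)) ∘ₗ f j := by
    intro i
    rw [arrowExt_arrowDefect, arrowExt_arrowDefect]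
    ext v
    simp only [LinearMap.smul_apply, LinearMap.add_apply, LinearMap.sub_apply,
      LinearMap.comp_apply, map_sub, map_zsmul]
    rw [sub_add_sub_cancel, smul_sub]
  rw [Finset.sum_congr rfl fun i _ => h i, Finset.sum_sub_distrib]
  have h1 : ∑ i, f j ∘ₗ (sgn G i j • (R.Q j i ∘ₗ R.Q i j))
      = f j ∘ₗ ∑ i, (sgn G i j • (R.Q j i ∘ₗ R.Q i j)) := by
    ext v
    simp
  have h2 : ∑ i, (sgn G i j • (S.Q j i ∘ₗ S.Q i j)) ∘ₗ f j
      = (∑ i, sgn G i j • (S.Q j i ∘ₗ S.Q i j)) ∘ₗ f j := by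
    ext v
    simp
  rw [h1, h2, hR.relation, hS.relation]
  ext v
  simp

/-- The trace pairing between families of maps in opposite directions. -/
noncomputable def tracePairing :
    (∀ i, S.V i →ₗ[k] R.V i) →ₗ[k] (∀ i, R.V i →ₗ[k] S.V i) →ₗ[k] k :=
  LinearMap.mk₂ k (fun h f => ∑ i, LinearMap.trace k (R.V i) (h i ∘ₗ f i))
    (fun h h' f => by simp [LinearMap.add_comp, Finset.sum_add_distrib])
    (fun c h f => by simp [LinearMap.smul_comp, Finset.mul_sum])
    (fun h f f' => by simp [LinearMap.comp_add, Finset.sum_add_distrib])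
    (fun c h f => by simp [LinearMap.comp_smul, Finset.mul_sum])

theorem tracePairing_apply (h : ∀ i, S.V i →ₗ[k] R.V i) (f : ∀ i, R.V i →ₗ[k] S.V i) :
    tracePairing R S h f = ∑ i, LinearMap.trace k (R.V i) (h i ∘ₗ f i) := rfl

/-- Cyclicity of the trace and antisymmetry of the signs make the linearized relation the transpose,
up to signs, of the commutation defect for maps from `S` to `R`. -/
theorem tracePairing_relationDefect (h : ∀ i, S.V i →ₗ[k] R.V i) (g : ArrowMaps R S) :
    tracePairing R S h (relationDefect R S g) = ∑ j, ∑ i, sgn G i j •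
      LinearMap.trace k (R.V j) ((h j ∘ₗ S.Q j i - R.Q j i ∘ₗ h i) ∘ₗ arrowExt R S i j g) := by
  have hj : ∀ j, LinearMap.trace k (R.V j) (h j ∘ₗ relationDefect R S g j)
      = ∑ i, sgn G i j • LinearMap.trace k (R.V j) (h j ∘ₗ (arrowExt R S j i g ∘ₗ R.Q i j))
        + ∑ i, sgn G i j • LinearMap.trace k (R.V j) ((h j ∘ₗ S.Q j i) ∘ₗ arrowExt R S i j g) := by
    intro j
    rw [← Finset.sum_add_distrib]
    have : h j ∘ₗ relationDefect R S g j = ∑ i, sgn G i j •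
        (h j ∘ₗ (arrowExt R S j i g ∘ₗ R.Q i j) + (h j ∘ₗ S.Q j i) ∘ₗ arrowExt R S i j g) := by
      ext v
      simp [relationDefect]
    rw [this, map_sum]
    simp only [map_zsmul, map_add, smul_add]
  rw [tracePairing_apply, Finset.sum_congr rfl fun j _ => hj j, Finset.sum_add_distrib,
    Finset.sum_comm, ← Finset.sum_add_distrib]
  refine Finset.sum_congr rfl fun j _ => ?_
  rw [← Finset.sum_add_distrib]
  refine Finset.sum_congr rfl fun i _ => ?_
  have ht : LinearMap.trace k (R.V i) (h i ∘ₗ (arrowExt R S i j g ∘ₗ R.Q j i))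
      = LinearMap.trace k (R.V j) ((R.Q j i ∘ₗ h i) ∘ₗ arrowExt R S i j g) := by
    rw [LinearMap.trace_comp_comm', LinearMap.comp_assoc, LinearMap.trace_comp_comm']
  rw [LinearMap.sub_comp, map_sub, sgn_swap, neg_smul, smul_sub, sub_eq_add_neg, add_comm, ht]

variable {R S} in
theorem mem_homs_of_tracePairing {h : ∀ i, S.V i →ₗ[k] R.V i}
    (hh : ∀ g, tracePairing R S h (relationDefect R S g) = 0) : h ∈ homs S R := by
  classical
  intro b a
  by_cases hab : G.Adj a b
  · rw [← sub_eq_zero]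
    refine eq_zero_of_trace_comp fun A => ?_
    -- Testing against a family concentrated on one arrow isolates one commutation relation, up to
    -- the sign `sgn G a b`.
    have hA := hh (Pi.single ⟨(a, b), hab⟩ A)
    rw [tracePairing_relationDefect, Finset.sum_eq_single b, Finset.sum_eq_single a,
      arrowExt_of_adj hab, Pi.single_eq_same] at hA
    · have := congrArg (sgn G a b • ·) hA
      rwa [smul_smul, sgn_mul_self hab, one_smul, smul_zero] at this
    · intro i _ hi
      by_cases hib : G.Adj i b
      · rw [arrowExt_of_adj hib, Pi.single_eq_of_ne, LinearMap.comp_zero, map_zero, smul_zero]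
        intro he
        exact hi (congrArg (fun p => p.1.1) he)
      · rw [arrowExt_of_not_adj hib, LinearMap.comp_zero, map_zero, smul_zero]
    · simp
    · intro j _ hj
      refine Finset.sum_eq_zero fun i _ => ?_
      by_cases hij : G.Adj i j
      · rw [arrowExt_of_adj hij, Pi.single_eq_of_ne, LinearMap.comp_zero, map_zero, smul_zero]
        intro he
        exact hj (congrArg (fun p => p.1.2) he)
      · rw [arrowExt_of_not_adj hij, LinearMap.comp_zero, map_zero, smul_zero]
    · simp
  · have hba : ¬ G.Adj b a := fun h' => hab h'.symm
    rw [R.Q_eq_zero b a hba, S.Q_eq_zero b a hba, LinearMap.comp_zero, LinearMap.zero_comp]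

theorem finrank_maps :
    (Module.finrank k (∀ i, R.V i →ₗ[k] S.V i) : ℤ) = ∑ i, R.dim i * S.dim i := by
  rw [Module.finrank_pi_fintype]
  simp [Module.finrank_linearMap, dim]

open Classical in
theorem finrank_arrowMaps : (Module.finrank k (ArrowMaps R S) : ℤ)
    = ∑ i, ∑ j, if G.Adj i j then R.dim i * S.dim j else 0 := by
  rw [Module.finrank_pi_fintype, Finset.sum_comm, ← Finset.sum_product', ← Finset.sum_filter,
    Finset.sum_subtype (p := fun p : Fin n × Fin n => G.Adj p.1 p.2)
      (F := inferInstance)]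
  · simp [Module.finrank_linearMap, dim]
  · intro p
    rw [Finset.mem_filter, G.adj_comm p.1]
    exact and_iff_right (Finset.mem_product.2 ⟨Finset.mem_univ _, Finset.mem_univ _⟩)

variable {R S} in
/-- The Cartan form bounds the dimensions of the spaces of homomorphisms from below. -/
theorem bform_dim_le {x : k} (hR : R.LoopsActBy x) (hS : S.LoopsActBy x) :
    bform G R.dim S.dim ≤ Module.finrank k (homs R S) + Module.finrank k (homs S R) := by
  classical
  rw [bform_eq_sub, ← finrank_maps, ← finrank_arrowMaps]
  have h1 := LinearMap.finrank_range_add_finrank_ker (arrowDefect R S)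
  have h2 := LinearMap.finrank_range_add_finrank_ker (relationDefect R S)
  have h3 := Submodule.finrank_mono (ker_arrowDefect_le R S)
  have h4 : LinearMap.range (arrowDefect R S) ≤ LinearMap.ker (relationDefect R S) := by
    rintro _ ⟨f, rfl⟩
    exact relationDefect_arrowDefect hR hS f
  have h5 := Submodule.finrank_mono h4
  -- The pairing sends maps from `S` to `R` into the dual of the image of the linearized relation.
  -- Its kernel lies in Hom(S, R), which bounds that image from below.
  set ψ := (tracePairing R S).compl₂ (LinearMap.range (relationDefect R S)).subtype with hψ
  have h6 := LinearMap.finrank_range_add_finrank_ker ψ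
  have h7 : LinearMap.ker ψ ≤ homs S R := by
    intro h hh
    refine mem_homs_of_tracePairing fun g => ?_
    have := LinearMap.congr_fun (LinearMap.mem_ker.1 hh) ⟨_, LinearMap.mem_range_self _ g⟩
    simpa [hψ] using this
  have h8 := Submodule.finrank_mono h7
  have h9 := Submodule.finrank_le (LinearMap.range ψ)
  have h10 : Module.finrank k (LinearMap.range (relationDefect R S) →ₗ[k] k)
      = Module.finrank k (LinearMap.range (relationDefect R S)) := Subspace.dual_finrank_eq
  have h11 : (Module.finrank k (∀ i, S.V i →ₗ[k] R.V i) : ℤ)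
      = Module.finrank k (∀ i, R.V i →ₗ[k] S.V i) := by
    rw [finrank_maps, finrank_maps]
    simp only [mul_comm]
  -- With `N` and `M` the dimensions of the vertex and arrow maps, `N - dim Hom(S, R) ≤ rank
  -- relationDefect ≤ M - rank arrowDefect ≤ M - N + dim Hom(R, S)`, and the form equals `2N - M`.
  omega

variable {R S}

theorem ker_isSubrep {x : k} (hR : R.LoopsActBy x) {f : ∀ i, R.V i →ₗ[k] S.V i}
    (hf : f ∈ homs R S) : R.IsSubrep fun i => LinearMap.ker (f i) := by
  constructor
  · intro i v hv
    rw [hR i v]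
    exact Submodule.smul_mem _ _ hv
  · intro i j v hv
    rw [LinearMap.mem_ker] at hv ⊢
    have := LinearMap.congr_fun (hf i j) v
    simp only [LinearMap.comp_apply] at this
    rw [this, hv, map_zero]

theorem range_isSubrep {x : k} (hS : S.LoopsActBy x) {f : ∀ i, R.V i →ₗ[k] S.V i}
    (hf : f ∈ homs R S) : S.IsSubrep fun i => LinearMap.range (f i) := by
  constructor
  · intro i v hv
    rw [hS i v]
    exact Submodule.smul_mem _ _ hv
  · rintro i j _ ⟨v, rfl⟩
    exact ⟨R.Q i j v, LinearMap.congr_fun (hf i j) v⟩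

theorem IsSimple.iso_of_mem_homs {x : k} (hR : R.IsSimple) (hS : S.IsSimple)
    (hRx : R.LoopsActBy x) (hSx : S.LoopsActBy x) {f : ∀ i, R.V i →ₗ[k] S.V i}
    (hf : f ∈ homs R S) (hf0 : f ≠ 0) : R.Iso S := by
  have hker : ∀ i, LinearMap.ker (f i) = ⊥ := by
    rcases hR.2 _ (ker_isSubrep hRx hf) with h | h
    · exact h
    · exact absurd (funext fun i => LinearMap.ker_eq_top.1 (h i)) hf0
  have hrange : ∀ i, LinearMap.range (f i) = ⊤ := by
    rcases hS.2 _ (range_isSubrep hSx hf) with h | h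
    · exact absurd (funext fun i => LinearMap.range_eq_bot.1 (h i)) hf0
    · exact h
  refine ⟨fun i => LinearEquiv.ofBijective (f i)
    ⟨LinearMap.ker_eq_bot.1 (hker i), LinearMap.range_eq_top.1 (hrange i)⟩, ?_, ?_⟩
  · intro i v
    rw [hRx i v, hSx, map_smul]
  · intro i j v
    exact LinearMap.congr_fun (hf i j) v

/-- Two simple representations with the same scalar are isomorphic if their dimension vectors pair
positively. -/
theorem IsSimple.iso_of_bform_pos {x : k} (hR : R.IsSimple) (hS : S.IsSimple)
    (hRx : R.LoopsActBy x) (hSx : S.LoopsActBy x) (h : 0 < bform G R.dim S.dim) : R.Iso S := by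
  have hle := bform_dim_le hRx hSx
  by_cases h1 : homs R S = ⊥
  · by_cases h2 : homs S R = ⊥
    · rw [h1, h2] at hle
      simp at hle
      omega
    · obtain ⟨f, hf, hf0⟩ := Submodule.exists_mem_ne_zero_of_ne_bot h2
      exact (hS.iso_of_mem_homs hR hSx hRx hf hf0).symm
  · obtain ⟨f, hf, hf0⟩ := Submodule.exists_mem_ne_zero_of_ne_bot h1
    exact hR.iso_of_mem_homs hS hRx hSx hf hf0

/-- Schur's lemma: subtracting an eigenvalue at one vertex leaves an endomorphism with nonzero
kernel, hence zero. -/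
theorem IsSimple.finrank_homs_self_le [IsAlgClosed k] {x : k} (hR : R.IsSimple)
    (hRx : R.LoopsActBy x) : Module.finrank k (homs R R) ≤ 1 := by
  have hid : (fun i => LinearMap.id) ∈ homs R R := fun i j => rfl
  refine finrank_le_one ⟨_, hid⟩ fun ⟨f, hf⟩ => ?_
  obtain ⟨i, hi⟩ := hR.1
  obtain ⟨c, hc⟩ := Module.End.exists_eigenvalue (f i)
  refine ⟨c, Subtype.ext ?_⟩
  have hg := Submodule.sub_mem _ hf (Submodule.smul_mem _ c hid)
  rcases hR.2 _ (ker_isSubrep hRx hg) with h | h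
  · refine absurd ?_ hc
    refine (Module.End.eigenspace_def (f := f i) (μ := c)).trans ?_
    rw [← h i]
    rfl
  · exact (sub_eq_zero.1 (funext fun i => LinearMap.ker_eq_top.1 (h i))).symm

/-- Schur's lemma bounds the length by 1 + 1, while evenness and positive definiteness bound it
below by 2. -/
theorem IsSimple.bform_dim [IsAlgClosed k] (hG : PosDef G) (hR : R.IsSimple) :
    bform G R.dim R.dim = 2 := by
  obtain ⟨x, hx⟩ := hR.exists_loopsActBy
  have h1 := bform_dim_le hx hx
  have h2 := hR.finrank_homs_self_le hx
  have h3 := hG.two_le hR.dim_ne_zero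
  omega

end Rep

end RepTheory

/-! ### Reflection functors and existence of representations -/

section Existence

variable {k : Type u} [Field k] {n : ℕ} {G : SimpleGraph (Fin n)} {P : Fin n → Polynomial k}

namespace Rep

/-- A representation with scalar loops, given by submodules of one vector space and maps between
them which are induced by endomorphisms. -/
def ofSubmodules (P : Fin n → Polynomial k) (x : k) {U : Type u} [AddCommGroup U] [Module k U]
    [Module.Finite k U] (W : Fin n → Submodule k U) (F : Fin n → Fin n → Module.End k U)
    (hF : ∀ i j, ∀ u ∈ W j, F i j u ∈ W i) (h0 : ∀ i j, ¬ G.Adj i j → F i j = 0)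
    (hrel : ∀ j, ∀ u ∈ W j, ∑ i, sgn G i j • F j i (F i j u) + (P j).eval x • u = 0) :
    Rep G P where
  V i := W i
  Φ i := algebraMap k (Module.End k (W i)) x
  Q i j := (F i j).restrict (hF i j)
  Q_eq_zero i j h := by
    ext u
    simp [LinearMap.restrict_apply, h0 i j h]
  relation j := by
    ext u
    rw [Polynomial.aeval_algebraMap_apply_eq_algebraMap_eval]
    simpa [LinearMap.restrict_apply] using hrel j u u.2
  comm i j := by
    ext u
    simp [LinearMap.restrict_apply]

theorem loopsActBy_ofSubmodules (x : k) {U : Type u} [AddCommGroup U] [Module k U]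
    [Module.Finite k U] (W : Fin n → Submodule k U) (F : Fin n → Fin n → Module.End k U)
    (hF : ∀ i j, ∀ u ∈ W j, F i j u ∈ W i) (h0 : ∀ i j, ¬ G.Adj i j → F i j = 0)
    (hrel : ∀ j, ∀ u ∈ W j, ∑ i, sgn G i j • F j i (F i j u) + (P j).eval x • u = 0) :
    (ofSubmodules P x W F hF h0 hrel).LoopsActBy x := fun _ _ => rfl

/-- The start of the induction. Constant polynomials with zero loops encode arbitrary weights `w`,
which reflections can then change freely. -/
theorem exists_dim_single (w : Fin n → k) (i : Fin n) (hi : w i = 0) :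
    ∃ T : Rep G (fun j => Polynomial.C (w j)), T.LoopsActBy 0 ∧ T.dim = Pi.single i 1 := by
  refine ⟨ofSubmodules _ 0 (U := k) (fun j => if j = i then ⊤ else ⊥) (fun _ _ => 0) ?_ ?_ ?_,
    loopsActBy_ofSubmodules _ _ _ _ _ _, ?_⟩
  · intro _ _ _ _
    exact Submodule.zero_mem _
  · intro _ _ _
    rfl
  · intro j u hu
    by_cases hj : j = i
    · simp [hj, hi]
    · rw [if_neg hj, Submodule.mem_bot] at hu
      simp [hu]
  · funext j
    change (Module.finrank k (if j = i then ⊤ else ⊥ : Submodule k k) : ℤ) = _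
    by_cases hj : j = i
    · subst hj
      rw [if_pos rfl, finrank_top]
      simp
    · simp [hj]

section Reflection

variable {w : Fin n → k} (T : Rep G fun j => Polynomial.C (w j)) (i : Fin n)

/-- The sum of the maps out of the vertex `i`. -/
def outMap : T.V i →ₗ[k] (∀ j, T.V j) := LinearMap.pi fun l => T.Q l i

/-- The signed sum of the maps into the vertex `i`. -/
noncomputable def inMap : (∀ j, T.V j) →ₗ[k] T.V i :=
  ∑ l, sgn G l i • (T.Q i l ∘ₗ LinearMap.proj l)

theorem inMap_apply (u : ∀ j, T.V j) : T.inMap i u = ∑ l, sgn G l i • T.Q i l (u l) := by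
  simp [inMap]

theorem inMap_single (j : Fin n) (v : T.V j) :
    T.inMap i (Pi.single j v) = sgn G j i • T.Q i j v := by
  rw [inMap_apply, Finset.sum_eq_single j]
  · rw [Pi.single_eq_same]
  · intro l _ hl
    rw [Pi.single_eq_of_ne hl, map_zero, smul_zero]
  · simp

variable {T} in
theorem LoopsActBy.sum_sgn_smul_apply (hT : T.LoopsActBy 0) (j : Fin n) (v : T.V j) :
    ∑ l, sgn G l j • T.Q j l (T.Q l j v) = -(w j • v) := by
  have := LinearMap.congr_fun (hT.relation j) v
  simpa using this

variable {T} in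
theorem LoopsActBy.inMap_outMap (hT : T.LoopsActBy 0) (v : T.V i) :
    T.inMap i (T.outMap i v) = -(w i • v) := by
  rw [inMap_apply]
  exact hT.sum_sgn_smul_apply i v

theorem outMap_apply_of_not_adj {l : Fin n} (h : ¬ G.Adj i l) (v : T.V i) :
    T.outMap i v l = 0 := by
  change T.Q l i v = 0
  rw [T.Q_eq_zero l i fun h' => h h'.symm, LinearMap.zero_apply]

/-- The map whose kernel is the reflected space at the vertex `i`. -/
noncomputable def reflectMap :
    (∀ j, T.V j) →ₗ[k] T.V i × (∀ l : {l : Fin n // ¬ G.Adj i l}, T.V l) :=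
  (T.inMap i).prod (LinearMap.pi fun l => LinearMap.proj (l : Fin n))

theorem mem_ker_reflectMap (u : ∀ j, T.V j) : u ∈ LinearMap.ker (T.reflectMap i) ↔
    T.inMap i u = 0 ∧ ∀ l, ¬ G.Adj i l → u l = 0 := by
  rw [LinearMap.mem_ker]
  change (T.inMap i u, fun l : {l : Fin n // ¬ G.Adj i l} => u l) = 0 ↔ _
  rw [Prod.mk_eq_zero]
  refine and_congr_right fun _ => ⟨fun h l hl => congrFun h ⟨l, hl⟩, fun h => funext fun l => ?_⟩
  exact h l l.2

-- Since `inMap` after `outMap` is `-w i`, a nonzero weight makes `inMap` split surjective. The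
-- section `-(w i)⁻¹ • outMap` is supported on the neighbours of `i`, so the other coordinates can
-- be prescribed independently.
variable {T} in
theorem LoopsActBy.reflectMap_surjective (hT : T.LoopsActBy 0) (hi : w i ≠ 0) :
    Function.Surjective (T.reflectMap i) := by
  classical
  rintro ⟨v, t⟩
  set u : ∀ j, T.V j := fun l => if h : G.Adj i l then 0 else t ⟨l, h⟩ with hu
  have hu0 : T.inMap i u = 0 := by
    rw [inMap_apply]
    refine Finset.sum_eq_zero fun l _ => ?_
    by_cases h : G.Adj i l
    · simp [hu, h]
    · rw [T.Q_eq_zero i l h, LinearMap.zero_apply, smul_zero]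
  refine ⟨u - (w i)⁻¹ • T.outMap i v, Prod.ext ?_ (funext fun l => ?_)⟩
  · change T.inMap i _ = v
    rw [map_sub, map_smul, hT.inMap_outMap, hu0, smul_neg, smul_smul, inv_mul_cancel₀ hi]
    simp
  · change u l - (w i)⁻¹ • T.outMap i v l = t l
    rw [T.outMap_apply_of_not_adj i l.2, smul_zero, sub_zero, hu]
    exact dif_neg l.2

variable {T} in
theorem LoopsActBy.finrank_ker_reflectMap (hT : T.LoopsActBy 0) (hi : w i ≠ 0) :
    (Module.finrank k (LinearMap.ker (T.reflectMap i)) : ℤ) = reflectionMap G i T.dim i := by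
  classical
  have h := LinearMap.finrank_range_add_finrank_ker (T.reflectMap i)
  rw [LinearMap.range_eq_top.2 (hT.reflectMap_surjective i hi), finrank_top,
    Module.finrank_prod, Module.finrank_pi_fintype, Module.finrank_pi_fintype] at h
  have hs : ∑ l : {l : Fin n // ¬ G.Adj i l}, Module.finrank k (T.V l)
      = ∑ l with ¬ G.Adj i l, Module.finrank k (T.V l) :=
    (Finset.sum_subtype _ (by simp) fun l => Module.finrank k (T.V l)).symm
  rw [hs, ← Finset.sum_filter_add_sum_filter_not Finset.univ (fun l => G.Adj i l)] at h
  rw [reflectionMap_apply, if_pos rfl]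
  simp only [dim]
  rw [← Nat.cast_sum]
  have h' : Module.finrank k (T.V i) + Module.finrank k (LinearMap.ker (T.reflectMap i))
      = ∑ l with G.Adj i l, Module.finrank k (T.V l) := by omega
  rw [← h']
  push_cast
  ring

open Classical in
/-- The spaces of the reflected representation. -/
noncomputable def reflectSpace (j : Fin n) : Submodule k (∀ j, T.V j) :=
  if j = i then LinearMap.ker (T.reflectMap i) else LinearMap.range (LinearMap.single k T.V j)

open Classical in
/-- The arrows of the reflected representation. -/
noncomputable def reflectArrow (a b : Fin n) : Module.End k (∀ j, T.V j) :=
  if b = i then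
    if G.Adj i a then LinearMap.single k T.V a ∘ₗ LinearMap.proj a else 0
  else if a = i then
    -- The operator `w i + outMap ∘ inMap` maps into the kernel of `inMap`, as `inMap ∘ outMap = -w
    -- i`. For nonzero `w i` it is `w i` times the projection along the image of `outMap`.
    if G.Adj i b then sgn G b i • ((w i • LinearMap.id + T.outMap i ∘ₗ T.inMap i) ∘ₗ
      LinearMap.single k T.V b ∘ₗ LinearMap.proj b) else 0
  else LinearMap.single k T.V a ∘ₗ T.Q a b ∘ₗ LinearMap.proj b

theorem reflectArrow_eq_zero {a b : Fin n} (h : ¬ G.Adj a b) : T.reflectArrow i a b = 0 := by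
  unfold reflectArrow
  by_cases hb : b = i
  · subst hb
    rw [if_pos rfl, if_neg fun h' => h h'.symm]
  · rw [if_neg hb]
    by_cases ha : a = i
    · subst ha
      rw [if_pos rfl, if_neg h]
    · rw [if_neg ha, T.Q_eq_zero a b h, LinearMap.zero_comp, LinearMap.comp_zero]

variable {i}

theorem reflectArrow_out {a : Fin n} (h : G.Adj i a) (u : ∀ j, T.V j) :
    T.reflectArrow i a i u = Pi.single a (u a) := by
  rw [reflectArrow, if_pos rfl, if_pos h]
  rfl

theorem reflectArrow_in {b : Fin n} (h : G.Adj i b) (u : ∀ j, T.V j) :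
    T.reflectArrow i i b u = sgn G b i •
      (w i • Pi.single b (u b) + T.outMap i (T.inMap i (Pi.single b (u b)))) := by
  rw [reflectArrow, if_neg h.ne', if_pos rfl, if_pos h]
  rfl

theorem reflectArrow_of_ne {a b : Fin n} (ha : a ≠ i) (hb : b ≠ i) (u : ∀ j, T.V j) :
    T.reflectArrow i a b u = Pi.single a (T.Q a b (u b)) := by
  rw [reflectArrow, if_neg hb, if_neg ha]
  rfl

theorem single_mem_reflectSpace {j : Fin n} (hj : j ≠ i) (v : T.V j) :
    Pi.single j v ∈ T.reflectSpace i j := by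
  rw [reflectSpace, if_neg hj]
  exact ⟨v, rfl⟩

variable {T} in
theorem LoopsActBy.reflectArrow_mem (hT : T.LoopsActBy 0) (a b : Fin n) (u : ∀ j, T.V j) :
    T.reflectArrow i a b u ∈ T.reflectSpace i a := by
  by_cases h : G.Adj a b
  · by_cases ha : a = i
    · subst ha
      rw [T.reflectArrow_in h, reflectSpace, if_pos rfl]
      refine zsmul_mem ((T.mem_ker_reflectMap _ _).2 ⟨?_, fun l hl => ?_⟩) _
      · rw [map_add, map_smul, hT.inMap_outMap, add_neg_cancel]
      · have hlb : l ≠ b := fun hlb => hl (hlb ▸ h)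
        rw [Pi.add_apply, Pi.smul_apply, Pi.single_eq_of_ne hlb, T.outMap_apply_of_not_adj a hl,
          smul_zero, add_zero]
    · by_cases hb : b = i
      · subst hb
        rw [T.reflectArrow_out h.symm]
        exact T.single_mem_reflectSpace ha _
      · rw [T.reflectArrow_of_ne ha hb]
        exact T.single_mem_reflectSpace ha _
  · rw [T.reflectArrow_eq_zero i h]
    exact Submodule.zero_mem _

/-- The components of `u` sum to `u`, and the `outMap` terms sum to the image of `inMap u = 0`. The
weight at `i` thus becomes `-w i`. -/
theorem relation_reflect_self (u : ∀ j, T.V j) (hu : u ∈ T.reflectSpace i i) :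
    ∑ a, sgn G a i • T.reflectArrow i i a (T.reflectArrow i a i u) = w i • u := by
  rw [reflectSpace, if_pos rfl, mem_ker_reflectMap] at hu
  have h : ∀ a, sgn G a i • T.reflectArrow i i a (T.reflectArrow i a i u)
      = w i • Pi.single a (u a) + T.outMap i (T.inMap i (Pi.single a (u a))) := by
    intro a
    by_cases ha : G.Adj i a
    · rw [T.reflectArrow_out ha, T.reflectArrow_in ha, Pi.single_eq_same, smul_smul,
        sgn_mul_self ha.symm, one_smul]
    · rw [sgn_of_not_adj fun h => ha h.symm, hu.2 a ha]
      simp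
  rw [Finset.sum_congr rfl fun a _ => h a, Finset.sum_add_distrib, ← Finset.smul_sum, ← map_sum,
    ← map_sum, Finset.univ_sum_single, hu.1, map_zero, add_zero]

variable {T} in
theorem LoopsActBy.relation_reflect_of_ne (hT : T.LoopsActBy 0) {j : Fin n} (hj : j ≠ i)
    (u : ∀ j, T.V j) (hu : u ∈ T.reflectSpace i j) :
    ∑ a, sgn G a j • T.reflectArrow i j a (T.reflectArrow i a j u)
      = -((w j - cartan G (Pi.single i 1) j • w i) • u) := by
  classical
  rw [reflectSpace, if_neg hj] at hu
  obtain ⟨v, rfl⟩ := hu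
  change ∑ a, sgn G a j • T.reflectArrow i j a (T.reflectArrow i a j (Pi.single j v))
    = -((w j - cartan G (Pi.single i 1) j • w i) • Pi.single j v)
  have hc : cartan G (Pi.single i 1) j = if G.Adj j i then -1 else 0 := by
    rw [cartan_eq, Pi.single_eq_of_ne hj]
    simp only [Pi.single_apply, Finset.sum_ite_eq', Finset.mem_filter, Finset.mem_univ, true_and]
    split_ifs <;> rfl
  -- Only the path from `j` through `i` and back changes. For `j` adjacent to `i` it gains `-w i`,
  -- so the weight at `j` grows by `w i`.
  have h : ∀ a, sgn G a j • T.reflectArrow i j a (T.reflectArrow i a j (Pi.single j v))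
      = Pi.single j (sgn G a j • T.Q j a (T.Q a j v))
        + if a = i then (cartan G (Pi.single i 1) j • w i) • Pi.single j v else 0 := by
    intro a
    by_cases haj : G.Adj a j
    · by_cases ha : a = i
      · subst ha
        rw [if_pos rfl, hc, if_pos haj.symm, T.reflectArrow_in haj, map_zsmul,
          T.reflectArrow_out haj, Pi.single_eq_same, T.inMap_single, Pi.add_apply, Pi.smul_apply,
          Pi.single_eq_same, map_zsmul, sgn_swap G a j]
        have hs := sgn_mul_self haj
        change sgn G a j • -sgn G a j • Pi.single j (w a • v + (-sgn G a j) • T.Q j a (T.Q a j v))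
          = _
        rw [smul_smul, mul_neg, hs, neg_smul, one_smul, ← Pi.single_neg, neg_add, neg_smul, neg_neg,
          Pi.single_add, add_comm, neg_smul, one_smul, neg_smul, Pi.single_neg, Pi.single_smul,
          Pi.single_smul]
      · rw [if_neg ha, add_zero, T.reflectArrow_of_ne ha hj, T.reflectArrow_of_ne hj ha,
          Pi.single_eq_same, Pi.single_eq_same, Pi.single_smul]
    · rw [sgn_of_not_adj haj]
      by_cases ha : a = i
      · subst ha
        rw [hc, if_neg fun h' : G.Adj j a => haj h'.symm]
        simp
      · simp [ha]
  rw [Finset.sum_congr rfl fun a _ => h a, Finset.sum_add_distrib, Finset.sum_ite_eq',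
    if_pos (Finset.mem_univ i)]
  have hsum : ∑ a, (Pi.single j (sgn G a j • T.Q j a (T.Q a j v)) : ∀ j, T.V j)
      = Pi.single j (-(w j • v)) := by
    rw [← hT.sum_sgn_smul_apply]
    exact (map_sum (LinearMap.single k T.V j) _ _).symm
  rw [hsum, Pi.single_neg, Pi.single_smul, sub_smul, neg_sub, sub_eq_add_neg, add_comm]

/-- The reflection at a vertex with nonzero weight, applied to a representation. -/
theorem LoopsActBy.exists_reflect {T : Rep G fun j => Polynomial.C (w j)} (hT : T.LoopsActBy 0)
    (hi : w i ≠ 0) {w' : Fin n → k} (hw' : ∀ j, w' j = w j - cartan G (Pi.single i 1) j • w i) :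
    ∃ T' : Rep G (fun j => Polynomial.C (w' j)),
      T'.LoopsActBy 0 ∧ T'.dim = reflectionMap G i T.dim := by
  classical
  refine ⟨ofSubmodules _ 0 (T.reflectSpace i) (T.reflectArrow i)
    (fun a b u _ => hT.reflectArrow_mem a b u) (fun a b h => T.reflectArrow_eq_zero i h) ?_,
    loopsActBy_ofSubmodules _ _ _ _ _ _, ?_⟩
  · intro j u hu
    rw [Polynomial.eval_C, hw' j]
    by_cases hj : j = i
    · subst hj
      rw [T.relation_reflect_self u hu, cartan, bform_single_self, two_smul, ← add_smul]
      simp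
    · rw [hT.relation_reflect_of_ne hj u hu, neg_add_cancel]
  · funext j
    change (Module.finrank k (T.reflectSpace i j) : ℤ) = _
    by_cases hj : j = i
    · subst hj
      rw [reflectSpace, if_pos rfl, hT.finrank_ker_reflectMap j hi]
    · rw [reflectSpace, if_neg hj, reflectionMap_apply, if_neg hj, dim,
        LinearMap.finrank_range_of_inj (Pi.single_injective j)]

end Reflection

/-- Reflecting weights is adjoint to reflecting dimension vectors, so orthogonality to the weights
is preserved when both are reflected. -/
theorem sum_reflectionMap_smul (w : Fin n → k) (i : Fin n) (b : Fin n → ℤ) :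
    ∑ j, reflectionMap G i b j • w j
      = ∑ j, b j • (w j - cartan G (Pi.single i 1) j • w i) := by
  have h : ∀ j, (Pi.single i 1 : Fin n → ℤ) j • w j = if j = i then w i else 0 := by
    intro j
    by_cases hj : j = i
    · subst hj
      simp
    · simp [hj]
  simp only [reflectionMap_eq, Pi.sub_apply, Pi.smul_apply, smul_eq_mul, sub_smul, smul_sub,
    Finset.sum_sub_distrib, mul_smul, ← Finset.smul_sum, h, Finset.sum_ite_eq', Finset.mem_univ,
    if_true]
  simp only [smul_smul, ← Finset.sum_smul]
  rw [← bform_eq_sum_cartan, bform_comm]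
  rfl

/-- Existence of a representation whose dimension vector is a positive root orthogonal to the
weights, if only its multiples are orthogonal to the weights. -/
theorem exists_dim_eq (hG : PosDef G) (α : Fin n → ℤ) (h0 : 0 ≤ α) (h2 : bform G α α = 2)
    (w : Fin n → k) (hw : ∑ j, α j • w j = 0)
    (hstar : ∀ b : Fin n → ℤ, b ≠ 0 → ∑ j, b j • w j = 0 → ∃ p q : ℤ, q ≠ 0 ∧ q • b = p • α) :
    ∃ T : Rep G (fun j => Polynomial.C (w j)), T.LoopsActBy 0 ∧ T.dim = α := by
  revert w
  -- The weights must vary in the induction, since each reflection changes them with the root.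
  refine hG.induction (motive := fun α => ∀ w : Fin n → k, ∑ j, α j • w j = 0 →
    (∀ b : Fin n → ℤ, b ≠ 0 → ∑ j, b j • w j = 0 → ∃ p q : ℤ, q ≠ 0 ∧ q • b = p • α) →
    ∃ T : Rep G (fun j => Polynomial.C (w j)), T.LoopsActBy 0 ∧ T.dim = α) ?_ ?_ α h0 h2
  · intro i w hw _
    refine exists_dim_single w i ?_
    rw [Finset.sum_eq_single i] at hw
    · simpa using hw
    · intro j _ hj
      simp [hj]
    · simp
  · intro α i h2 _ hc ih w hw hstar
    -- Otherwise `ε_i` is orthogonal to the weights, so `q • ε_i = p • α` with `q ≠ 0`. Pairing with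
    -- `α` and with `ε_i` gives `q = 2p` and `2q = p`, a contradiction.
    have hi : w i ≠ 0 := by
      intro hi
      obtain ⟨p, q, hq, h⟩ := hstar (Pi.single i 1) (by simp) (by
        refine Finset.sum_eq_zero fun j _ => ?_
        by_cases hj : j = i
        · simp [hj, hi]
        · simp [hj])
      have h1 := congrArg (fun x => bform G x α) h
      have h3 := congrArg (fun x => bform G (Pi.single i 1) x) h
      simp only [map_smul, LinearMap.smul_apply, smul_eq_mul, h2, bform_single_self] at h1 h3
      rw [← cartan, hc] at h1 h3
      omega
    have hr := reflectionMap_involutive G i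
    obtain ⟨T, hT, hdim⟩ := ih (fun j => w j - cartan G (Pi.single i 1) j • w i)
      (by rw [← sum_reflectionMap_smul, hr, hw]) (by
        intro b hb hb0
        rw [← sum_reflectionMap_smul] at hb0
        obtain ⟨p, q, hq, h⟩ := hstar (reflectionMap G i b)
          (fun h => hb (by rw [← hr b, h, map_zero])) hb0
        refine ⟨p, q, hq, ?_⟩
        rw [← map_smul, ← h, map_smul, hr])
    -- The reflected weight at `i` is `-w i ≠ 0`, so the functor applies again, and reflecting twice
    -- restores `w` and `α`.
    obtain ⟨T', hT', hdim'⟩ := hT.exists_reflect (i := i) (w' := w)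
      (by simpa [cartan, bform_single_self, two_smul] using hi)
      (fun j => by simp [cartan, bform_single_self, two_smul])
    exact ⟨T', hT', by rw [hdim', hdim, hr]⟩

end Rep

end Existence

/-! ### Simplicity, uniqueness and counting -/

section Classification

variable {k : Type u} [Field k] {n : ℕ} {G : SimpleGraph (Fin n)} {P : Fin n → Polynomial k}

namespace Rep

/-- The restriction of a representation to a subrepresentation. -/
def restrict (R : Rep G P) {x : k} (hR : R.LoopsActBy x) (W : ∀ i, Submodule k (R.V i))
    (hW : R.IsSubrep W) : Rep G P where
  V i := W i
  Φ i := algebraMap k (Module.End k (W i)) x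
  Q i j := (R.Q i j).restrict (hW.2 i j)
  Q_eq_zero i j h := by
    ext u
    simp [LinearMap.restrict_apply, R.Q_eq_zero i j h]
  relation j := by
    ext u
    have := LinearMap.congr_fun (hR.relation j) u
    rw [Polynomial.aeval_algebraMap_apply_eq_algebraMap_eval]
    simp only [LinearMap.sum_apply, LinearMap.smul_apply, LinearMap.comp_apply, neg_smul,
      LinearMap.neg_apply, LinearMap.id_apply] at this
    simp [LinearMap.restrict_apply, this]
  comm i j := by
    ext u
    simp [LinearMap.restrict_apply]

/-- Change of the polynomials and of the scalar by which the loops act. -/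
def changeLoops {P' : Fin n → Polynomial k} (R : Rep G P) {x : k} (hR : R.LoopsActBy x) (y : k)
    (h : ∀ j, (P j).eval x = (P' j).eval y) : Rep G P' where
  V := R.V
  Φ i := algebraMap k (Module.End k (R.V i)) y
  Q := R.Q
  Q_eq_zero := R.Q_eq_zero
  relation j := by
    rw [hR.relation j, Polynomial.aeval_algebraMap_apply_eq_algebraMap_eval, h j, neg_smul]
    exact neg_add_cancel _
  comm i j := by
    ext u
    simp

/-- A representation whose dimension vector has square length two is simple, if every vector
orthogonal to the weights is proportional to the dimension vector. -/
theorem LoopsActBy.isSimple (hG : PosDef G) (hstar : StarCondition P) {R : Rep G P} {x : k}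
    (hR : R.LoopsActBy x) (h2 : bform G R.dim R.dim = 2) : R.IsSimple := by
  have hne : R.dim ≠ 0 := by
    intro h
    simp [h] at h2
  refine ⟨?_, fun W hW => ?_⟩
  · by_contra! h
    refine hne (funext fun i => ?_)
    have := h i
    change (Module.finrank k (R.V i) : ℤ) = 0
    rw [Module.finrank_zero_of_subsingleton, Nat.cast_zero]
  · set S := R.restrict hR W hW with hS
    have hSx : S.LoopsActBy x := fun _ _ => rfl
    have hdim : ∀ i, S.dim i = Module.finrank k (W i) := fun _ => rfl
    have hle : ∀ i, S.dim i ≤ R.dim i := fun i => by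
      rw [hdim, dim]
      exact_mod_cast Submodule.finrank_le (W i)
    by_cases h0 : S.dim = 0
    · left
      intro i
      have := congrFun h0 i
      rw [hdim, Pi.zero_apply] at this
      exact Submodule.finrank_eq_zero.1 (by exact_mod_cast this)
    · right
      -- The trace identity holds for the subrepresentation too, so `(*)` makes its dimension vector
      -- `c` times that of `R`. Integrality gives `c ^ 2 ≥ 1`, so wherever `R` is nonzero, `c ≥ 1`
      -- and the subspace is everything.
      obtain ⟨c, hc⟩ := hstar R.dim S.dim hne h0 ⟨x, hR.isRoot_comb_dim, hSx.isRoot_comb_dim⟩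
      have hc1 := (hG.one_le_sq_of_proportional h2 h0 hc).2
      intro i
      refine Submodule.eq_top_of_finrank_eq (le_antisymm (Submodule.finrank_le _) ?_)
      have hRi : (0 : ℚ) ≤ R.dim i := by exact_mod_cast R.dim_nonneg i
      have hSi : (0 : ℚ) ≤ S.dim i := by exact_mod_cast S.dim_nonneg i
      have : R.dim i ≤ S.dim i := by
        rcases hRi.eq_or_lt with h | h
        · have : R.dim i = 0 := by exact_mod_cast h.symm
          rw [this]
          exact S.dim_nonneg i
        · have hcpos : 0 ≤ c := by
            rw [hc i] at hSi
            exact nonneg_of_mul_nonneg_left hSi h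
          have : (1 : ℚ) ≤ c := by nlinarith
          have : (R.dim i : ℚ) ≤ S.dim i := by
            rw [hc i]
            nlinarith
          exact_mod_cast this
      rw [hdim, dim] at this
      exact_mod_cast this

theorem exists_isSimple (hG : PosDef G) (hstar : StarCondition P) {α : Fin n → ℤ} (h0 : 0 ≤ α)
    (h2 : bform G α α = 2) {x : k} (hx : (comb P α).IsRoot x) :
    ∃ R : Rep G P, R.IsSimple ∧ R.LoopsActBy x ∧ R.dim = α := by
  have hα : α ≠ 0 := by
    rintro rfl
    simp at h2
  -- Construct the module for the constant weights `P_j(x)` with zero loops, then replace the loops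
  -- by `x`.
  obtain ⟨T, hT, hdim⟩ := exists_dim_eq hG α h0 h2 (fun j => (P j).eval x)
    (by rw [← eval_comb]; exact hx) (by
      intro b hb hb0
      rw [← eval_comb] at hb0
      obtain ⟨c, hc⟩ := hstar α b hα hb ⟨x, hx, hb0⟩
      refine ⟨c.num, c.den, by exact_mod_cast c.den_ne_zero, funext fun i => ?_⟩
      have : (c.den : ℚ) * b i = c.num * α i := by
        rw [hc i, ← mul_assoc, mul_comm (c.den : ℚ), Rat.mul_den_eq_num]
      simp only [Pi.smul_apply, smul_eq_mul]
      exact_mod_cast this)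
  set R : Rep G P := T.changeLoops hT x (fun j => by simp) with hR
  have hRx : R.LoopsActBy x := fun _ _ => rfl
  have hRd : R.dim = α := hdim
  exact ⟨R, hRx.isSimple hG hstar (hRd ▸ h2), hRx, hRd⟩

theorem IsSimple.isPositiveRoot_dim [IsAlgClosed k] (hG : PosDef G) {R : Rep G P}
    (hR : R.IsSimple) : IsPositiveRoot G R.dim :=
  hG.isPositiveRoot R.dim_nonneg (hR.bform_dim hG)

/-- Both vectors are annihilated by the weights at `x`, hence proportional. Equal length leaves only
a sign, which nonnegativity fixes. -/
theorem IsSimple.dim_eq_of_loopsActBy [IsAlgClosed k] (hG : PosDef G) (hstar : StarCondition P)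
    {R S : Rep G P} (hR : R.IsSimple) (hS : S.IsSimple) {x : k} (hRx : R.LoopsActBy x)
    (hSx : S.LoopsActBy x) : S.dim = R.dim := by
  obtain ⟨c, hc⟩ := hstar R.dim S.dim hR.dim_ne_zero hS.dim_ne_zero
    ⟨x, hRx.isRoot_comb_dim, hSx.isRoot_comb_dim⟩
  rcases hG.eq_or_eq_neg (hR.bform_dim hG) (hS.bform_dim hG) hc with h | h
  · exact h
  · refine absurd (le_antisymm ?_ R.dim_nonneg) hR.dim_ne_zero
    have := S.dim_nonneg
    rw [h] at this
    exact neg_nonneg.1 this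

/-- At most one simple representation has its loops acting by a given scalar. -/
theorem IsSimple.iso_of_loopsActBy [IsAlgClosed k] (hG : PosDef G) (hstar : StarCondition P)
    {R S : Rep G P} (hR : R.IsSimple) (hS : S.IsSimple) {x : k} (hRx : R.LoopsActBy x)
    (hSx : S.LoopsActBy x) : R.Iso S := by
  refine hR.iso_of_bform_pos hS hRx hSx ?_
  rw [hR.dim_eq_of_loopsActBy hG hstar hS hRx hSx, hR.bform_dim hG]
  norm_num

theorem IsSimple.loopsActBy_unique {R S : Rep G P} (hR : R.IsSimple) (h : R.Iso S) {x y : k}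
    (hRx : R.LoopsActBy x) (hSy : S.LoopsActBy y) : x = y := by
  obtain ⟨⟨i, hi⟩, -⟩ := hR
  obtain ⟨f, hf, -⟩ := h
  obtain ⟨v, hv⟩ := exists_ne (0 : R.V i)
  have := hf i v
  rw [hRx, hSy, map_smul] at this
  exact smul_left_injective k ((f i).map_ne_zero_iff.2 hv) this

end Rep

theorem comb_neg (P : Fin n → Polynomial k) (α : Fin n → ℤ) : comb P (-α) = -comb P α := by
  simp [comb]

theorem IsRoot.comb_mem {α : Fin n → ℤ} (h : IsRoot G α) (P : Fin n → Polynomial k) :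
    comb P α ∈ weylPolynomials G P := by
  obtain ⟨w, hw, j, rfl⟩ := h
  exact ⟨w, hw, j, rfl⟩

theorem HasSimpleRoots.ne_zero {p : Polynomial k} (h : HasSimpleRoots p) : p ≠ 0 := by
  rintro rfl
  exact h 0 (by simp) (by simp)

open Classical in
theorem HasSimpleRoots.card_roots [IsAlgClosed k] {p : Polynomial k} (h : HasSimpleRoots p) :
    p.roots.toFinset.card = p.natDegree := by
  have hnd : p.roots.Nodup := by
    rw [Multiset.nodup_iff_count_le_one]
    intro x
    rw [Polynomial.count_roots]
    by_contra! hx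
    have := (Polynomial.one_lt_rootMultiplicity_iff_isRoot h.ne_zero).1 hx
    exact h x this.1 this.2
  rw [Multiset.toFinset_card_of_nodup hnd]
  exact (IsAlgClosed.splits p).natDegree_eq_card_roots.symm

/-- The isomorphism classes of simple representations with a given positive root as dimension
vector correspond to the roots of the polynomial attached to it. -/
theorem ncard_simpleClass_dim_eq [IsAlgClosed k] (hG : PosDef G) (hstar : StarCondition P)
    {α : Fin n → ℤ} (hα : IsPositiveRoot G α) (hp : HasSimpleRoots (comb P α)) :
    {c : SimpleClass G P | c.dim = α}.Finite ∧
      {c : SimpleClass G P | c.dim = α}.ncard = (comb P α).natDegree := by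
  classical
  have hroot : ∀ x : (comb P α).roots.toFinset,
      ∃ R : Rep G P, R.IsSimple ∧ R.LoopsActBy x ∧ R.dim = α := fun x =>
    Rep.exists_isSimple hG hstar hα.2.le hα.1.bform_self
      (Polynomial.isRoot_of_mem_roots (Multiset.mem_toFinset.1 x.2))
  choose R hR hRx hRd using hroot
  set f : (comb P α).roots.toFinset → SimpleClass G P := fun x =>
    Quotient.mk (simpleSetoid G P) ⟨R x, hR x⟩ with hf
  -- The scalar by which the loops act is an isomorphism invariant.
  have hinj : Function.Injective f := by
    intro x y hxy
    have hiso : (R x).Iso (R y) := Quotient.exact hxy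
    exact Subtype.ext ((hR x).loopsActBy_unique hiso (hRx x) (hRx y))
  -- Any simple of dimension `α` has its scalar among the roots by the trace identity, and is then
  -- the chosen one by uniqueness.
  have hrange : Set.range f = {c : SimpleClass G P | c.dim = α} := by
    ext c
    constructor
    · rintro ⟨x, rfl⟩
      exact hRd x
    · obtain ⟨S, rfl⟩ := Quotient.exists_rep c
      intro hSd
      replace hSd : S.1.dim = α := hSd
      obtain ⟨x, hx⟩ := S.2.exists_loopsActBy
      have hxr := hx.isRoot_comb_dim
      rw [hSd] at hxr
      have hmem : x ∈ (comb P α).roots.toFinset :=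
        Multiset.mem_toFinset.2 ((Polynomial.mem_roots hp.ne_zero).2 hxr)
      exact ⟨⟨x, hmem⟩, Quotient.sound
        ((hR ⟨x, hmem⟩).iso_of_loopsActBy hG hstar S.2 (hRx ⟨x, hmem⟩) hx)⟩
  rw [← hrange]
  refine ⟨Set.finite_range f, ?_⟩
  rw [← Set.image_univ, Set.ncard_image_of_injective _ hinj, Set.ncard_univ,
    Nat.card_eq_fintype_card, Fintype.card_coe, hp.card_roots]

end Classification

end N1ADE

theorem mainTheorem2 {k : Type*} [Field k] [IsAlgClosed k] (Γ : N1ADE.DynkinType)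
    (P : Fin Γ.rank → Polynomial k)
    (hB : ∀ p ∈ N1ADE.weylPolynomials Γ.graph P, N1ADE.HasSimpleRoots p)
    (hstar : N1ADE.StarCondition P) :
    -- every simple representation has a positive root `α` as its dimension vector, and its loops
    -- act by a root of the polynomial `∑ i, α_i P_i`
    (∀ R : N1ADE.Rep Γ.graph P, R.IsSimple →
      N1ADE.IsPositiveRoot Γ.graph R.dim ∧
        ∃ x : k, R.LoopsActBy x ∧ (N1ADE.comb P R.dim).IsRoot x) ∧
    -- every root of a polynomial `p` in `{w (P_j)}` gives a simple representation, unique up to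
    -- isomorphism, and its dimension vector is the positive root belonging to `p`
    (∀ p ∈ N1ADE.weylPolynomials Γ.graph P, ∀ x : k, p.IsRoot x →
      ∃ R : N1ADE.Rep Γ.graph P, R.IsSimple ∧ R.LoopsActBy x ∧
        N1ADE.IsPositiveRoot Γ.graph R.dim ∧
        (p = N1ADE.comb P R.dim ∨ p = - N1ADE.comb P R.dim) ∧
        ∀ S : N1ADE.Rep Γ.graph P, S.IsSimple → S.LoopsActBy x → S.Iso R) ∧
    -- the map from isomorphism classes of simple representations to positive roots is
    -- finite-to-one, with fibres of the stated size
    (∀ α : Fin Γ.rank → ℤ, N1ADE.IsPositiveRoot Γ.graph α →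
      {c : N1ADE.SimpleClass Γ.graph P | c.dim = α}.Finite ∧
        {c : N1ADE.SimpleClass Γ.graph P | c.dim = α}.ncard
          = (N1ADE.comb P α).natDegree) := by
  have hG := Γ.posDef_graph
  refine ⟨fun R hR => ?_, ?_, fun α hα => ?_⟩
  · obtain ⟨x, hx⟩ := hR.exists_loopsActBy
    exact ⟨hR.isPositiveRoot_dim hG, x, hx, hx.isRoot_comb_dim⟩
  · rintro p ⟨w, hw, j, rfl⟩ x hx
    have hβ : N1ADE.IsRoot Γ.graph (w (Pi.single j 1)) := ⟨w, hw, j, rfl⟩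
    generalize w (Pi.single j 1) = β at hβ hx
    -- Whichever of `β` and `-β` is nonnegative is taken as dimension vector; this is the sign in `p
    -- = ±P_α`.
    obtain ⟨α, hα, h0, hp⟩ : ∃ α, N1ADE.IsRoot Γ.graph α ∧ 0 ≤ α ∧
        (N1ADE.comb P β = N1ADE.comb P α ∨ N1ADE.comb P β = -N1ADE.comb P α) := by
      rcases hG.nonneg_or_nonpos hβ.bform_self with h | h
      · exact ⟨β, hβ, h, Or.inl rfl⟩
      · exact ⟨-β, hβ.neg, h, Or.inr (by rw [N1ADE.comb_neg, neg_neg])⟩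
    have hxα : (N1ADE.comb P α).IsRoot x := by
      rcases hp with h | h <;> rw [h] at hx
      · exact hx
      · simpa using hx
    obtain ⟨R, hR, hRx, rfl⟩ := N1ADE.Rep.exists_isSimple hG hstar h0 hα.bform_self hxα
    exact ⟨R, hR, hRx, hR.isPositiveRoot_dim hG, hp, fun S hS hSx =>
      hS.iso_of_loopsActBy hG hstar hR hSx hRx⟩
  · exact N1ADE.ncard_simpleClass_dim_eq hG hstar hα (hB _ (hα.1.comb_mem P))
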